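/- Let $n\ge 1$, let $\mathbb B^n$ be the open unit ball of $\mathbb C^n$ with $(z,w)=\sum_i z_i\overline{w_i}$, and let $G=\mathrm{SU}(n,1)$ be the group of complex $(n+1)\times(n+1)$ matrices $x=\begin{pmatrix}A&b\\ c^t&d\end{pmatrix}$ ($A$ of size $n\times n$, $b,c\in\mathbb C^n$, $d\in\mathbb C$) of determinant $1$ with $x^*Jx=J$, $J=\mathrm{diag}(-1,\dots,-1,1)$. It acts on $\mathbb B^n$ by $x\cdot z=(Az+b)(c^tz+d)^{-1}$. Let $dx$ be a Haar measure on $G$. For $\beta\in\mathbb R$ and $1\le p<\infty$ let $L^p_\beta(G)$ be the $L^p$ space of the measure $(1-|x\cdot 0|^2)^\beta\,dx$ on $G$. Let $s>n$, and let $\mathcal H_s$ be the Hilbert space of the holomorphic functions on $\mathbb B^n$ that are square integrable for $dv_{s-n-1}$, where $dv_\gamma$ is the measure $(1-|z|^2)^{\gamma}\,dz$ normalized to mass $1$, with inner product $(f,g)_{\mathcal H_s}=\int_{\mathbb B^n} f\bar g\,dv_{s-n-1}$. Let $\rho_s$ be the projective representation of $G$ on $\mathcal H_s$ given by $$\rho_s(x)f(z)=(-(z,b)+\overline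 d)^{-s}f(x^{-1}\cdot z):=a(x)\,\overline d^{\,-s}\,\bigl(1-(z,b)/\overline d\bigr)^{-s}f(x^{-1}\cdot z),$$ where the powers on the right are principal and $a:G\to\mathbb T$ is any fixed Borel function with $a(1)=1$ that is smooth near the identity. Let $\sigma:G\times G\to\mathbb T$ be its multiplier, that is, $\sigma$ is Borel and $\rho_s(xy)=\sigma(x,y)\rho_s(x)\rho_s(y)$. A vector $u\in\mathcal H_s$ is smooth if $x\mapsto\rho_s(x)u\in\mathcal H_s$ is $C^\infty$ on a neighbourhood of the identity of $G$. Put $W_u^{\rho_s}(v)(x)=(v,\rho_s(x)u)_{\mathcal H_s}$, and $$f*g(x)=\int_G f(y)g(y^{-1}x)\,dy,\qquad f\#g(x)=\int_G f(y)g(y^{-1}x)\,\overline{\sigma(y,y^{-1}x)}\,dy .$$ Theorem. Let $1\le p<\infty$ and $-1<\alpha<p(s-n)-1$, and let $u,v$ be smooth vectors for $\rho_s$. Then the convolution operator $f\mapsto f*|W_u^{\rho_s}(v)|$ is a continuous linear operator on $L^p_{\alpha+n+1-sp/2}(G)$ (for every $f$ in this space the integral converges absolutely for almost every $x\in G$).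 In particular, the twisted convolution operator $f\mapsto f\#W_u^{\rho_s}(v)$ is a continuous linear operator on $L^p_{\alpha+n+1-sp/2}(G)$, again with almost everywhere absolutely convergent integrals. -/

import Mathlib

open MeasureTheory Topology
open scoped ENNReal Matrix

namespace BallBergman

/-! ### The group `SU(n,1)` and its action on the unit ball -/

/-- The matrix `diag(-1, …, -1, 1)`. -/
noncomputable def J (n : ℕ) : Matrix (Fin n ⊕ Unit) (Fin n ⊕ Unit) ℂ :=
  Matrix.fromBlocks (-1) 0 0 1

/-- `SU(n,1)`: the complex matrices `x` of determinant `1` with `x* J x = J`. It carries the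
subspace topology of the matrix space. -/
noncomputable def SU (n : ℕ) : Subgroup (Matrix.SpecialLinearGroup (Fin n ⊕ Unit) ℂ) where
  carrier := {x | (x.1)ᴴ * J n * x.1 = J n}
  one_mem' := by simp
  mul_mem' := by
    intro x y hx hy
    simp only [Set.mem_ofPred_eq] at hx hy ⊢
    calc ((x * y).1)ᴴ * J n * (x * y).1
        = (y.1)ᴴ * ((x.1)ᴴ * J n * x.1) * y.1 := by
          simp [Matrix.mul_assoc, Matrix.conjTranspose_mul]
      _ = J n := by rw [hx, hy]
  inv_mem' := by
    intro x hx
    simp only [Set.mem_ofPred_eq] at hx ⊢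
    have h1 : x.1 * (x⁻¹).1 = 1 := by
      rw [← Matrix.SpecialLinearGroup.coe_mul, mul_inv_cancel, Matrix.SpecialLinearGroup.coe_one]
    have h2 : ((x⁻¹).1)ᴴ * (x.1)ᴴ = 1 := by
      rw [← Matrix.conjTranspose_mul, h1, Matrix.conjTranspose_one]
    calc ((x⁻¹).1)ᴴ * J n * (x⁻¹).1
        = ((x⁻¹).1)ᴴ * ((x.1)ᴴ * J n * x.1) * (x⁻¹).1 := by rw [hx]
      _ = (((x⁻¹).1)ᴴ * (x.1)ᴴ) * J n * (x.1 * (x⁻¹).1) := by simp only [Matrix.mul_assoc]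
      _ = J n := by rw [h1, h2, Matrix.one_mul, Matrix.mul_one]

noncomputable instance (n : ℕ) : MeasurableSpace (SU n) := borel _

instance (n : ℕ) : BorelSpace (SU n) := ⟨rfl⟩

variable {n : ℕ}

/-- The entries of a group element. -/
def entries (x : SU n) : (Fin n ⊕ Unit) → (Fin n ⊕ Unit) → ℂ := fun i j => x.1.1 i j

/-! Block form `x = (A b; cᵗ d)`. -/

noncomputable def blockA (x : SU n) : Matrix (Fin n) (Fin n) ℂ := fun i j => x.1.1 (Sum.inl i) (Sum.inl j)

noncomputable def blockB (x : SU n) : Fin n → ℂ := fun i => x.1.1 (Sum.inl i) (Sum.inr ())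

noncomputable def blockC (x : SU n) : Fin n → ℂ := fun j => x.1.1 (Sum.inr ()) (Sum.inl j)

noncomputable def blockD (x : SU n) : ℂ := x.1.1 (Sum.inr ()) (Sum.inr ())

/-- The open unit ball of `ℂⁿ`. -/
def unitBall (n : ℕ) : Set (EuclideanSpace ℂ (Fin n)) := Metric.ball 0 1

/-- The action `x · z = (A z + b) / (cᵗ z + d)`. -/
noncomputable def act (x : SU n) (z : EuclideanSpace ℂ (Fin n)) : EuclideanSpace ℂ (Fin n) :=
  WithLp.toLp 2 fun i =>
    ((∑ j, blockA x i j * z j) + blockB x i) * ((∑ j, blockC x j * z j) + blockD x)⁻¹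

/-! ### Weighted Bergman spaces on the ball -/

/-- The measure `(1 - |z|²)^α dz` on the ball (zero outside the ball). -/
noncomputable def rawBallMeasure (n : ℕ) (α : ℝ) : Measure (EuclideanSpace ℂ (Fin n)) :=
  (volume.restrict (unitBall n)).withDensity fun z => ENNReal.ofReal ((1 - ‖z‖ ^ 2) ^ α)

/-- `dv_α`, the measure `(1 - |z|²)^α dz` normalized to a probability measure (for `α > -1`). -/
noncomputable def ballMeasure (n : ℕ) (α : ℝ) : Measure (EuclideanSpace ℂ (Fin n)) :=
  (rawBallMeasure n α Set.univ)⁻¹ • rawBallMeasure n α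

/-- `f` belongs to `H_s = A²_{s-n-1}`: it is holomorphic on the ball and square integrable for
`dv_{s-n-1}`. Only the values of `f` on the ball matter. -/
def MemH (s : ℝ) (f : EuclideanSpace ℂ (Fin n) → ℂ) : Prop :=
  DifferentiableOn ℂ f (unitBall n) ∧ MemLp f 2 (ballMeasure n (s - n - 1))

/-- The inner product of `H_s`, linear in the first variable. -/
noncomputable def innerH (s : ℝ) (f g : EuclideanSpace ℂ (Fin n) → ℂ) : ℂ :=
  ∫ z, f z * star (g z) ∂(ballMeasure n (s - n - 1))

/-! ### The projective representation `ρ_s` -/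

/-- `q : SU(n,1) → E` is `C^∞` on a neighbourhood of the identity: near the identity it is the
restriction of a `C^∞` function of the matrix entries (`SU(n,1)` is an embedded real submanifold
of the space of matrices). -/
def SmoothNearOne {E : Type*} [NormedAddCommGroup E] [NormedSpace ℝ E] (q : SU n → E) : Prop :=
  ∃ U : Set ((Fin n ⊕ Unit) → (Fin n ⊕ Unit) → ℂ), IsOpen U ∧ entries (1 : SU n) ∈ U ∧
    ∃ Q : ((Fin n ⊕ Unit) → (Fin n ⊕ Unit) → ℂ) → E,
      ContDiffOn ℝ ((⊤ : ℕ∞) : WithTop ℕ∞) Q U ∧ ∀ x : SU n, entries x ∈ U → q x = Q (entries x)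

/-- A choice of the phase left open by the multivalued power in the definition of `ρ_s`:
a Borel function `a : SU(n,1) → 𝕋` with `a 1 = 1` which is smooth near the identity. -/
structure IsPhase (a : SU n → Circle) : Prop where
  measurable : Measurable fun x => (a x : ℂ)
  map_one : a 1 = 1
  smooth : SmoothNearOne fun x => (a x : ℂ)

/-- `ρ_s(x) f (z) = (-(z,b) + conj d)^{-s} f (x⁻¹ · z)`. Since `|b| < |d|`, the number
`1 - (z,b) / conj d` has positive real part on the ball, and the power is
`a(x) (conj d)^{-s} (1 - (z,b) / conj d)^{-s}` with principal powers and a phase `a`;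
every choice of a branch is of this form. -/
noncomputable def rho (a : SU n → Circle) (s : ℝ) (x : SU n)
    (f : EuclideanSpace ℂ (Fin n) → ℂ) (z : EuclideanSpace ℂ (Fin n)) : ℂ :=
  (a x : ℂ) * (star (blockD x)) ^ (-(s : ℂ)) *
    (1 - (∑ i, z i * star (blockB x i)) / star (blockD x)) ^ (-(s : ℂ)) * f (act x⁻¹ z)

/-- `σ` is the multiplier of `ρ_s`: a Borel function `G × G → 𝕋` with
`ρ_s(xy) = σ(x,y) ρ_s(x) ρ_s(y)` on `H_s`. -/
def IsMultiplier (a : SU n → Circle) (s : ℝ) (σ : SU n → SU n → Circle) : Prop :=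
  Measurable (fun r : SU n × SU n => (σ r.1 r.2 : ℂ)) ∧
    ∀ x y : SU n, ∀ f : EuclideanSpace ℂ (Fin n) → ℂ, MemH s f → ∀ z ∈ unitBall n,
      rho a s (x * y) f z = (σ x y : ℂ) * rho a s x (rho a s y f) z

/-- `u ∈ H_s` is a smooth vector: the map `x ↦ ρ_s(x) u`, with values in `H_s ⊆ L²(dv_{s-n-1})`,
is `C^∞` on a neighbourhood of the identity. -/
def IsSmoothVector (a : SU n → Circle) (s : ℝ) (u : EuclideanSpace ℂ (Fin n) → ℂ) : Prop :=
  MemH s u ∧ ∃ q : SU n → Lp ℂ 2 (ballMeasure n (s - n - 1)),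
    (∀ x, q x =ᵐ[ballMeasure n (s - n - 1)] rho a s x u) ∧ SmoothNearOne q

/-- The wavelet transform `W_u(v)(x) = (v, ρ_s(x) u)`. -/
noncomputable def wavelet (a : SU n → Circle) (s : ℝ) (u v : EuclideanSpace ℂ (Fin n) → ℂ)
    (x : SU n) : ℂ :=
  innerH s v (rho a s x u)

/-! ### Weighted Lebesgue spaces and convolutions on the group -/

/-- The measure `(1 - |x · 0|²)^β dx` on the group, where `dx = μ`; the space `L^p_β(G)` is the
`L^p` space of this measure. -/
noncomputable def weighted (μ : Measure (SU n)) (β : ℝ) : Measure (SU n) :=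
  μ.withDensity fun x => ENNReal.ofReal ((1 - ‖act x 0‖ ^ 2) ^ β)

/-- The twisted convolution
`f # g (x) = ∫ f(y) g(y⁻¹x) conj σ(y, y⁻¹x) dy`. -/
noncomputable def twistedConv (μ : Measure (SU n)) (σ : SU n → SU n → Circle)
    (f g : SU n → ℂ) (x : SU n) : ℂ :=
  ∫ y, f y * g (y⁻¹ * x) * star (σ y (y⁻¹ * x) : ℂ) ∂μ

/-- The convolution `f * g (x) = ∫ f(y) g(y⁻¹x) dy`. -/
noncomputable def conv (μ : Measure (SU n)) (f g : SU n → ℂ) (x : SU n) : ℂ :=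
  ∫ y, f y * g (y⁻¹ * x) ∂μ

end BallBergman

/-!
The operators are integral operators with kernels bounded by `|W(y⁻¹x)|`, `W = W_u(v)`, so the
theorem follows from a decay estimate for `W` and a Schur test on the group.

*Decay of `W`.* Smooth vectors are bounded functions on the ball
(`IsSmoothVector.exists_bound`). Only the one-parameter group
`diag(e^{iθ}, …, e^{iθ}, e^{-inθ})` is needed for this: up to a smooth phase it acts on `u` by the
rotations `u(e^{-i(n+1)θ} z)`, so these depend smoothly on `θ` in `L²`. Point evaluations are
restrictions of `L²`-functionals whose norms grow polynomially at the boundary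
(`exists_evaluation_functional`, by the mean value property). Hence, on every complex line through
`0`, all iterates of the Euler operator `ζ d/dζ` on `u` grow at most like one fixed power of
`1 / (1 - |ζ|)`; each radial integration lowers the power by one
(`exists_bound_of_iterate_euler_le`), and finally `u` is bounded.

With `w = x · 0` and `d` the lower right entry of `x`, `|ρ_s(x) u (z)|` is at most a constant times
`|d|^{-s} |1 - (z, w)|^{-s}`, where `1 - |w|² = |d|^{-2}`. The uniform Forelli–Rudin estimate
(`exists_forelliRudin_bound`) then gives `|W(x)| ≤ C |d|^{-τ}` for every `τ < s`
(`exists_norm_wavelet_le`).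

*Schur test.* The weight functions are powers `|d|^{-2t} = (1 - |x · 0|²)^t`, and by invariance
both marginal conditions reduce to the bound
`∫ |d(xg)|^{-2t} |d(g)|^{-τ} dg ≤ C |d(x)|^{-2t}` for `n - τ/2 < t < τ/2`
(`exists_lintegral_blockD_le`). That integral is estimated without any decomposition of the group:
the group acts on `ℂ^{n+1}` by linear maps that preserve Lebesgue measure and the Lorentz form,
hence also the shell where the form lies between two positive constants; averaging over the shell
turns the integral over the group into a Forelli–Rudin integral over the ball. The condition
`-1 < α < p(s - n) - 1` is exactly what makes both Schur weights admissible for some `τ < s`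
(`exists_decay_exponent`).
-/

namespace BallBergman


/-! ### Truncated powers and linear substitutions -/

/-- The truncated power `x₊ ^ γ` with values in `ℝ≥0∞`; it vanishes for `x ≤ 0`, whatever `γ`. -/
noncomputable def posPow (γ x : ℝ) : ℝ≥0∞ := if 0 < x then ENNReal.ofReal (x ^ γ) else 0

lemma posPow_of_pos {γ x : ℝ} (hx : 0 < x) : posPow γ x = ENNReal.ofReal (x ^ γ) := if_pos hx

lemma posPow_of_nonpos {γ x : ℝ} (hx : x ≤ 0) : posPow γ x = 0 := if_neg hx.not_gt

@[fun_prop]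
lemma measurable_posPow (γ : ℝ) : Measurable (posPow γ) := by
  unfold posPow
  exact Measurable.ite measurableSet_Ioi (by fun_prop) measurable_const

lemma posPow_mul {γ a x : ℝ} (ha : 0 < a) :
    posPow γ (a * x) = ENNReal.ofReal (a ^ γ) * posPow γ x := by
  rcases le_or_gt x 0 with hx | hx
  · rw [posPow_of_nonpos hx, posPow_of_nonpos (mul_nonpos_of_nonneg_of_nonpos ha.le hx), mul_zero]
  · rw [posPow_of_pos hx, posPow_of_pos (mul_pos ha hx), Real.mul_rpow ha.le hx.le,
      ENNReal.ofReal_mul (by positivity)]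

lemma lintegral_comp_complexLinear {V : Type*} [NormedAddCommGroup V] [NormedSpace ℂ V]
    [FiniteDimensional ℂ V] [MeasurableSpace V] [BorelSpace V] (ν : Measure V)
    [ν.IsAddHaarMeasure] (f : V →ₗ[ℂ] V) (hf : LinearMap.det f ≠ 0) {F : V → ℝ≥0∞}
    (hF : Measurable F) :
    ENNReal.ofReal (‖LinearMap.det f‖ ^ 2) * ∫⁻ v, F (f v) ∂ν = ∫⁻ v, F v ∂ν := by
  have : FiniteDimensional ℝ V := FiniteDimensional.complexToReal V
  have hdet : LinearMap.det (f.restrictScalars ℝ) = ‖LinearMap.det f‖ ^ 2 := by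
    rw [LinearMap.det_restrictScalars, Algebra.norm_complex_apply, Complex.normSq_eq_norm_sq]
  have h0 : (0 : ℝ) < ‖LinearMap.det f‖ ^ 2 := by positivity
  have hm := Measure.map_linearMap_addHaar_eq_smul_addHaar ν (f := f.restrictScalars ℝ)
    (by rw [hdet]; exact h0.ne')
  have hc : Measurable f := f.continuous_of_finiteDimensional.measurable
  have : ∫⁻ v, F (f v) ∂ν = ∫⁻ v, F v ∂(Measure.map (f.restrictScalars ℝ) ν) :=
    (lintegral_map hF hc).symm
  rw [this, hm, lintegral_smul_measure, hdet, smul_eq_mul, ← mul_assoc,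
    ← ENNReal.ofReal_mul h0.le, abs_of_pos (inv_pos.2 h0), mul_inv_cancel₀ h0.ne',
    ENNReal.ofReal_one, one_mul]

/-! ### The Forelli–Rudin bound on the disc -/

lemma abs_div_pi_le_norm_one_sub {r θ : ℝ} (hr : 0 ≤ r) (hθ : |θ| ≤ Real.pi) :
    |θ| / Real.pi ≤ ‖1 - (r : ℂ) * (Real.cos θ + Real.sin θ * Complex.I)‖ := by
  have hpi := Real.pi_pos
  have hn : ‖1 - (r : ℂ) * (Real.cos θ + Real.sin θ * Complex.I)‖ ^ 2
      = 1 - 2 * r * Real.cos θ + r ^ 2 := by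
    rw [← Complex.normSq_eq_norm_sq, Complex.normSq_apply]
    simp only [Complex.sub_re, Complex.one_re, Complex.mul_re, Complex.ofReal_re, Complex.add_re,
      Complex.I_re, Complex.ofReal_im, Complex.I_im, Complex.sub_im, Complex.one_im,
      Complex.mul_im, Complex.add_im]
    have := Real.sin_sq_add_cos_sq θ
    nlinarith [this]
  refine le_of_sq_le_sq ?_ (norm_nonneg _)
  rw [hn]
  rcases le_or_gt (Real.cos θ) 0 with hc | hc
  · have : |θ| / Real.pi ≤ 1 := by rw [div_le_one hpi]; exact hθ
    have h2 : 0 ≤ |θ| / Real.pi := by positivity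
    nlinarith [mul_nonneg hr (neg_nonneg.2 hc), sq_nonneg r]
  · have hθ2 : |θ| ≤ Real.pi / 2 := by
      by_contra! h
      have := Real.cos_nonpos_of_pi_div_two_le_of_le h.le (by linarith)
      rw [Real.cos_abs] at this
      linarith
    have hs := Real.mul_le_sin (abs_nonneg θ) hθ2
    have hs2 : Real.sin |θ| ^ 2 = 1 - Real.cos θ ^ 2 := by
      rw [← Real.cos_abs θ]; linarith [Real.sin_sq_add_cos_sq |θ|]
    have h2 : 0 ≤ |θ| / Real.pi := by positivity
    have h3 : |θ| / Real.pi ≤ Real.sin |θ| := by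
      refine le_trans ?_ hs
      rw [show 2 / Real.pi * |θ| = 2 * (|θ| / Real.pi) by ring]; linarith
    nlinarith [sq_nonneg (r - Real.cos θ)]

lemma lintegral_one_sub_rpow_lt_top {e : ℝ} (he : -1 < e) :
    ∫⁻ x in Set.Ioo (0 : ℝ) 1, ENNReal.ofReal ((1 - x) ^ e) < ⊤ := by
  have h := (intervalIntegral.intervalIntegrable_rpow' (a := 0) (b := 1) he).comp_sub_left 1
  simp only [sub_zero, sub_self] at h
  have h2 := (intervalIntegrable_iff_integrableOn_Ioo_of_le zero_le_one).1 h.symm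
  exact h2.lintegral_lt_top

lemma lintegral_abs_rpow_lt_top {e : ℝ} (he : -1 < e) (R : ℝ) (hR : 0 < R) :
    ∫⁻ x in Set.Ioo (-R) R, ENNReal.ofReal (|x| ^ e) < ⊤ := by
  have h1 : IntervalIntegrable (fun x : ℝ => |x| ^ e) volume 0 R :=
    (intervalIntegral.intervalIntegrable_rpow' he).congr (fun x hx => by
      rw [Set.uIoc_of_le hR.le] at hx
      simp only [abs_of_pos hx.1])
  have h2 := (IntervalIntegrable.iff_comp_neg (by finiteness)).1 h1
  simp only [abs_neg, neg_zero] at h2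
  exact ((intervalIntegrable_iff_integrableOn_Ioo_of_le (by linarith)).1
    (h2.symm.trans h1)).lintegral_lt_top

lemma one_sub_sq_rpow_le {e x : ℝ} (h0 : 0 ≤ x) (h1 : x < 1) :
    (1 - x ^ 2) ^ e ≤ 2 ^ |e| * (1 - x) ^ e := by
  rw [show 1 - x ^ 2 = (1 + x) * (1 - x) by ring, Real.mul_rpow (by linarith) (by linarith)]
  refine mul_le_mul_of_nonneg_right ?_ (Real.rpow_nonneg (by linarith) _)
  calc (1 + x) ^ e ≤ (1 + x) ^ |e| := Real.rpow_le_rpow_of_exponent_le (by linarith) (le_abs_self e)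
    _ ≤ 2 ^ |e| := Real.rpow_le_rpow (by linarith) (by linarith) (abs_nonneg e)

/-- The uniform Forelli–Rudin bound on the disc. The kernel is split as
`|1 - rζ| ^ (-κ₁ - κ₂)` with `κ₁ < 1`, absorbed by the angular variable, and `κ₂ < γ + 1`,
absorbed by the weight. -/
lemma exists_disc_bound {γ κ : ℝ} (hγ : -1 < γ) (hκ : κ < γ + 2) :
    ∃ C : ℝ≥0∞, C ≠ ⊤ ∧ ∀ r : ℝ, 0 ≤ r → r < 1 →
      ∫⁻ ζ : ℂ, posPow γ (1 - ‖ζ‖ ^ 2) * ENNReal.ofReal (‖1 - r * ζ‖ ^ (-κ)) ≤ C := by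
  obtain ⟨η, hη0, hη1, hη2, hη3⟩ : ∃ η : ℝ, 0 < η ∧ η ≤ 1 ∧ η ≤ γ + 1 ∧ κ ≤ γ + 2 - 2 * η := by
    refine ⟨min ((γ + 2 - κ) / 2) (min 1 (γ + 1)), ?_, ?_, ?_, ?_⟩
    · refine lt_min (by linarith) (lt_min one_pos (by linarith))
    · exact (min_le_right _ _).trans (min_le_left _ _)
    · exact (min_le_right _ _).trans (min_le_right _ _)
    · linarith [min_le_left ((γ + 2 - κ) / 2) (min 1 (γ + 1))]
  set K : ℝ := 2 ^ |γ| * 2 ^ (γ + 2 - 2 * η - κ) * Real.pi ^ (1 - η) with hK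
  have hpi := Real.pi_pos
  have hK0 : 0 ≤ K := by positivity
  set g1 : ℝ → ℝ≥0∞ := (Set.Ioo (0 : ℝ) 1).indicator fun x => ENNReal.ofReal ((1 - x) ^ (η - 1))
  set g2 : ℝ → ℝ≥0∞ := (Set.Ioo (-Real.pi) Real.pi).indicator
    fun x => ENNReal.ofReal (|x| ^ (η - 1))
  have hg1 : Measurable g1 := Measurable.indicator (by fun_prop) measurableSet_Ioo
  have hg2 : Measurable g2 := Measurable.indicator (by fun_prop) measurableSet_Ioo
  have hi1 : ∫⁻ x, g1 x ≠ ⊤ := by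
    rw [lintegral_indicator measurableSet_Ioo]
    exact (lintegral_one_sub_rpow_lt_top (by linarith)).ne
  have hi2 : ∫⁻ x, g2 x ≠ ⊤ := by
    rw [lintegral_indicator measurableSet_Ioo]
    exact (lintegral_abs_rpow_lt_top (by linarith) _ hpi).ne
  refine ⟨ENNReal.ofReal K * ((∫⁻ x, g1 x) * ∫⁻ x, g2 x),
    ENNReal.mul_ne_top ENNReal.ofReal_ne_top (ENNReal.mul_ne_top hi1 hi2), fun r hr0 hr1 => ?_⟩
  rw [← Complex.lintegral_comp_polarCoord_symm]
  calc _ ≤ ∫⁻ p in polarCoord.target, ENNReal.ofReal K * (g1 p.1 * g2 p.2) := ?_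
    _ ≤ ∫⁻ p : ℝ × ℝ, ENNReal.ofReal K * (g1 p.1 * g2 p.2) := setLIntegral_le_lintegral _ _
    _ = _ := by
      rw [lintegral_const_mul _ (by fun_prop), Measure.volume_eq_prod,
        lintegral_prod_mul hg1.aemeasurable hg2.aemeasurable]
  have hne : ∀ᵐ p : ℝ × ℝ, p.2 ≠ 0 := by
    have : ∀ᵐ θ : ℝ, θ ≠ 0 := by simp [ae_iff]
    rw [Measure.volume_eq_prod]
    exact Measure.quasiMeasurePreserving_snd.ae this
  refine lintegral_mono_ae ((ae_restrict_iff' polarCoord.open_target.measurableSet).2 ?_)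
  filter_upwards [hne] with p hp0 hp
  obtain ⟨ρ, θ⟩ := p
  simp only [polarCoord_target, Set.mem_prod, Set.mem_Ioi, Set.mem_Ioo] at hp hp0
  obtain ⟨hρ, hθ1, hθ2⟩ := hp
  have hθ : |θ| < Real.pi := abs_lt.2 ⟨hθ1, hθ2⟩
  have hnorm : ‖Complex.polarCoord.symm (ρ, θ)‖ = ρ := by
    rw [Complex.norm_polarCoord_symm, abs_of_pos hρ]
  simp only [hnorm, smul_eq_mul]
  rcases le_or_gt 1 ρ with h1 | h1
  · rw [posPow_of_nonpos (by nlinarith)]; simp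
  set X := ‖1 - r * Complex.polarCoord.symm (ρ, θ)‖ with hX
  have hXa : |θ| / Real.pi ≤ X := by
    have := abs_div_pi_le_norm_one_sub (mul_nonneg hr0 hρ.le) hθ.le
    rw [hX, Complex.polarCoord_symm_apply]
    simp only [Complex.ofReal_mul] at this
    rwa [mul_assoc] at this
  have hXb : 1 - ρ ≤ X := by
    have := norm_sub_norm_le (1 : ℂ) (r * Complex.polarCoord.symm (ρ, θ))
    rw [norm_mul, hnorm, norm_one, Complex.norm_real, Real.norm_of_nonneg hr0] at this
    nlinarith
  have hXc : X ≤ 2 := by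
    have := norm_sub_le (1 : ℂ) (r * Complex.polarCoord.symm (ρ, θ))
    rw [norm_mul, hnorm, norm_one, Complex.norm_real, Real.norm_of_nonneg hr0] at this
    nlinarith
  have hX0 : 0 < X := by linarith
  have hθ0 : 0 < |θ| := abs_pos.2 hp0
  have hpow : X ^ (-κ) ≤ 2 ^ (γ + 2 - 2 * η - κ) * (|θ| / Real.pi) ^ (η - 1)
      * (1 - ρ) ^ (-(γ + 1 - η)) := by
    rw [show -κ = (γ + 2 - 2 * η - κ) + (η - 1) + -(γ + 1 - η) by ring, Real.rpow_add hX0,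
      Real.rpow_add hX0]
    gcongr ?_ * ?_ * ?_
    · exact Real.rpow_le_rpow hX0.le hXc (by linarith)
    · exact Real.rpow_le_rpow_of_nonpos (by positivity) hXa (by linarith)
    · exact Real.rpow_le_rpow_of_nonpos (by linarith) hXb (by linarith)
  have hw := one_sub_sq_rpow_le (e := γ) hρ.le h1
  have h1ρ : 0 < 1 - ρ := by linarith
  simp only [g1, g2]
  rw [posPow_of_pos (by nlinarith), Set.indicator_of_mem (show ρ ∈ Set.Ioo (0 : ℝ) 1 from ⟨hρ, h1⟩),
    Set.indicator_of_mem (show θ ∈ Set.Ioo (-Real.pi) Real.pi from ⟨hθ1, hθ2⟩),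
    ← ENNReal.ofReal_mul (Real.rpow_nonneg h1ρ.le _), ← ENNReal.ofReal_mul hK0,
    ← ENNReal.ofReal_mul (Real.rpow_nonneg (by nlinarith) _), ← ENNReal.ofReal_mul hρ.le]
  refine ENNReal.ofReal_le_ofReal ?_
  calc ρ * ((1 - ρ ^ 2) ^ γ * X ^ (-κ)) ≤ 1 * ((1 - ρ ^ 2) ^ γ * X ^ (-κ)) := by
        refine mul_le_mul_of_nonneg_right h1.le
          (mul_nonneg (Real.rpow_nonneg (by nlinarith) _) (by positivity))
    _ ≤ 1 * ((2 ^ |γ| * (1 - ρ) ^ γ) * (2 ^ (γ + 2 - 2 * η - κ) * (|θ| / Real.pi) ^ (η - 1)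
      * (1 - ρ) ^ (-(γ + 1 - η)))) := by
        gcongr
    _ = K * ((1 - ρ) ^ (η - 1) * |θ| ^ (η - 1)) := by
        rw [Real.div_rpow (abs_nonneg _) hpi.le, hK,
          show (η - 1 : ℝ) = -(1 - η) by ring, Real.rpow_neg hpi.le,
          show (1 - ρ) ^ (-(1 - η)) = (1 - ρ) ^ γ * (1 - ρ) ^ (-(γ + 1 - η)) by
            rw [← Real.rpow_add h1ρ]; congr 1; ring]
        field_simp

lemma exists_lintegral_posPow_sub_sq_le {γ : ℝ} (hγ : -1 < γ) :
    ∃ C : ℝ≥0∞, C ≠ ⊤ ∧ ∀ A : ℝ,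
      ∫⁻ ζ : ℂ, posPow γ (A - ‖ζ‖ ^ 2) ≤ C * posPow (γ + 1) A := by
  obtain ⟨C, hC, h⟩ := exists_disc_bound (κ := 0) hγ (by linarith)
  refine ⟨C, hC, fun A => ?_⟩
  rcases le_or_gt A 0 with hA | hA
  · have : ∀ ζ : ℂ, posPow γ (A - ‖ζ‖ ^ 2) = 0 := fun ζ =>
      posPow_of_nonpos (by nlinarith [sq_nonneg ‖ζ‖])
    simp [this]
  have h0 : ∫⁻ ζ : ℂ, posPow γ (1 - ‖ζ‖ ^ 2) ≤ C := by
    simpa using h 0 le_rfl one_pos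
  -- the substitution `ζ ↦ √A ζ` reduces to `A = 1`
  let f : ℂ →ₗ[ℂ] ℂ := ((Real.sqrt A : ℝ) : ℂ) • LinearMap.id
  have hs : 0 < Real.sqrt A := Real.sqrt_pos.2 hA
  have hdet : LinearMap.det f = ((Real.sqrt A : ℝ) : ℂ) := by
    simp [f]
  rw [← lintegral_comp_complexLinear volume f (by rw [hdet]; exact_mod_cast hs.ne') (by fun_prop)]
  have hp : ∀ ζ : ℂ, posPow γ (A - ‖f ζ‖ ^ 2) =
      ENNReal.ofReal (A ^ γ) * posPow γ (1 - ‖ζ‖ ^ 2) := by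
    intro ζ
    rw [← posPow_mul hA]
    congr 1
    simp only [f, LinearMap.smul_apply, LinearMap.id_apply, smul_eq_mul, norm_mul,
      Complex.norm_real, Real.norm_of_nonneg hs.le, mul_pow, Real.sq_sqrt hA.le]
    ring
  simp_rw [hp]
  rw [lintegral_const_mul _ (by fun_prop), hdet, Complex.norm_real, Real.norm_of_nonneg hs.le,
    Real.sq_sqrt hA.le, posPow_of_pos hA, ← mul_assoc, ← ENNReal.ofReal_mul hA.le,
    Real.rpow_add_one hA.ne', mul_comm A, mul_comm]
  gcongr

/-! ### Slicing the ball -/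

lemma sum_norm_sq_insertNth {m : ℕ} (ζ : ℂ) (z : Fin m → ℂ) :
    ∑ i, ‖(Fin.insertNth (α := fun _ => ℂ) 0 ζ z) i‖ ^ 2 = ‖ζ‖ ^ 2 + ∑ i, ‖z i‖ ^ 2 := by
  rw [Fin.sum_univ_succ]; simp

lemma lintegral_fin_succ {m : ℕ} {F : (Fin (m + 1) → ℂ) → ℝ≥0∞} (hF : Measurable F) :
    ∫⁻ z, F z = ∫⁻ ζ : ℂ, ∫⁻ z : Fin m → ℂ, F (Fin.insertNth (α := fun _ => ℂ) 0 ζ z) := by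
  have h := (volume_preserving_piFinSuccAbove (fun _ : Fin (m + 1) => ℂ) 0).symm
  rw [← h.lintegral_comp hF, Measure.volume_eq_prod, lintegral_prod]
  · rfl
  · exact (hF.comp h.measurable).aemeasurable

lemma exists_lintegral_posPow_sub_sum_le {γ : ℝ} (hγ : -1 < γ) (m : ℕ) :
    ∃ C : ℝ≥0∞, C ≠ ⊤ ∧ ∀ A : ℝ,
      ∫⁻ z : Fin m → ℂ, posPow γ (A - ∑ i, ‖z i‖ ^ 2) ≤ C * posPow (γ + m) A := by
  induction m with
  | zero =>
    refine ⟨1, ENNReal.one_ne_top, fun A => ?_⟩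
    simp [volume_pi]
  | succ m ih =>
    obtain ⟨C1, hC1, h1⟩ := ih
    obtain ⟨C2, hC2, h2⟩ := exists_lintegral_posPow_sub_sq_le (γ := γ + m)
      (by have : (0 : ℝ) ≤ m := by positivity
          linarith)
    refine ⟨C1 * C2, ENNReal.mul_ne_top hC1 hC2, fun A => ?_⟩
    rw [lintegral_fin_succ (by fun_prop)]
    simp_rw [sum_norm_sq_insertNth, ← sub_sub]
    calc _ ≤ ∫⁻ ζ : ℂ, C1 * posPow (γ + m) (A - ‖ζ‖ ^ 2) := lintegral_mono fun ζ => h1 _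
      _ = C1 * ∫⁻ ζ : ℂ, posPow (γ + m) (A - ‖ζ‖ ^ 2) := lintegral_const_mul _ (by fun_prop)
      _ ≤ C1 * (C2 * posPow (γ + m + 1) A) := by gcongr; exact h2 A
      _ = _ := by rw [mul_assoc]; push_cast; rw [add_assoc]

lemma exists_slice_bound {γ κ : ℝ} (m : ℕ) (hγ : -1 < γ) (hκ : κ < γ + m + 2) :
    ∃ C : ℝ≥0∞, C ≠ ⊤ ∧ ∀ r : ℝ, 0 ≤ r → r < 1 →
      ∫⁻ z : Fin (m + 1) → ℂ, posPow γ (1 - ∑ i, ‖z i‖ ^ 2)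
        * ENNReal.ofReal (‖1 - r * z 0‖ ^ (-κ)) ≤ C := by
  obtain ⟨C1, hC1, h1⟩ := exists_lintegral_posPow_sub_sum_le hγ m
  obtain ⟨C2, hC2, h2⟩ := exists_disc_bound (γ := γ + m) (κ := κ)
    (by have : (0 : ℝ) ≤ m := by positivity
        linarith) hκ
  refine ⟨C1 * C2, ENNReal.mul_ne_top hC1 hC2, fun r hr0 hr1 => ?_⟩
  rw [lintegral_fin_succ (by fun_prop)]
  simp_rw [sum_norm_sq_insertNth, ← sub_sub, Fin.insertNth_apply_same]
  calc _ ≤ ∫⁻ ζ : ℂ, C1 * (posPow (γ + m) (1 - ‖ζ‖ ^ 2)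
        * ENNReal.ofReal (‖1 - r * ζ‖ ^ (-κ))) := lintegral_mono fun ζ => by
        simp only
        rw [lintegral_mul_const _ (by fun_prop), ← mul_assoc]
        gcongr
        exact h1 _
    _ = C1 * ∫⁻ ζ : ℂ, (posPow (γ + m) (1 - ‖ζ‖ ^ 2)
        * ENNReal.ofReal (‖1 - r * ζ‖ ^ (-κ))) := lintegral_const_mul _ (by fun_prop)
    _ ≤ _ := by gcongr; exact h2 r hr0 hr1


/-! ### The Forelli–Rudin bound on the ball -/

/-- The Lebesgue measure of the Hermitian space `ℂⁿ` is proportional to the product measure. -/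
lemma exists_volume_euclideanSpace_eq (n : ℕ) :
    ∃ c : ℝ≥0∞, c ≠ 0 ∧ c ≠ ⊤ ∧ ∀ F : EuclideanSpace ℂ (Fin n) → ℝ≥0∞, Measurable F →
      ∫⁻ z, F z = c * ∫⁻ z : Fin n → ℂ, F (WithLp.toLp 2 z) := by
  let e : (Fin n → ℂ) ≃L[ℝ] EuclideanSpace ℂ (Fin n) :=
    (PiLp.continuousLinearEquiv 2 ℝ (fun _ : Fin n => ℂ)).symm
  have he : Measurable e := e.continuous.measurable
  have hi : (Measure.map e volume).IsAddHaarMeasure := e.isAddHaarMeasure_map volume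
  have h := Measure.isAddLeftInvariant_eq_smul (volume : Measure (EuclideanSpace ℂ (Fin n)))
    (Measure.map e volume)
  set c := Measure.addHaarScalarFactor (volume : Measure (EuclideanSpace ℂ (Fin n)))
    (Measure.map e volume)
  refine ⟨c, ?_, ENNReal.coe_ne_top, fun F hF => ?_⟩
  · intro hc
    rw [ENNReal.coe_eq_zero] at hc
    rw [hc, zero_smul] at h
    exact NeZero.ne (volume : Measure (EuclideanSpace ℂ (Fin n))) h
  · calc ∫⁻ z, F z = ∫⁻ z, F z ∂(c • Measure.map e volume) := by rw [← h]
      _ = _ := by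
        rw [lintegral_smul_measure, lintegral_map hF he]
        rfl

/-- The uniform Forelli–Rudin bound: `∫ (1 - |z|²) ^ γ |1 - (z, w)| ^ (-κ) dz` is bounded in
`|w| < 1` when `κ < γ + n + 1`. -/
theorem exists_forelliRudin_bound {n : ℕ} (hn : 1 ≤ n) {γ κ : ℝ} (hγ : -1 < γ)
    (hκ : κ < γ + n + 1) :
    ∃ C : ℝ≥0∞, C ≠ ⊤ ∧ ∀ w : EuclideanSpace ℂ (Fin n), ‖w‖ < 1 →
      ∫⁻ z : EuclideanSpace ℂ (Fin n), posPow γ (1 - ‖z‖ ^ 2)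
        * ENNReal.ofReal (‖1 - inner ℂ w z‖ ^ (-κ)) ≤ C := by
  obtain ⟨m, rfl⟩ : ∃ m, n = m + 1 := ⟨n - 1, by omega⟩
  obtain ⟨c, -, hc, hvol⟩ := exists_volume_euclideanSpace_eq (m + 1)
  obtain ⟨C, hC, h⟩ := exists_slice_bound (γ := γ) (κ := κ) m hγ (by push_cast at hκ; linarith)
  refine ⟨c * C, ENNReal.mul_ne_top hc hC, fun w hw => ?_⟩
  -- a unitary change of coordinates moves `w` to the first axis
  obtain ⟨b, hb⟩ : ∃ b : OrthonormalBasis (Fin (m + 1)) ℂ (EuclideanSpace ℂ (Fin (m + 1))),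
      ∀ z, inner ℂ w z = (‖w‖ : ℂ) * b.repr z 0 := by
    rcases eq_or_ne w 0 with rfl | hw0
    · exact ⟨EuclideanSpace.basisFun _ _, fun z => by simp⟩
    · have hw1 : ‖w‖ ≠ 0 := norm_ne_zero_iff.2 hw0
      have hne : (‖w‖ : ℂ) ≠ 0 := by exact_mod_cast hw1
      obtain ⟨b, hb⟩ := Orthonormal.exists_orthonormalBasis_extension_of_card_eq (𝕜 := ℂ)
        (E := EuclideanSpace ℂ (Fin (m + 1))) (ι := Fin (m + 1)) (by simp)
        (v := fun _ => ((‖w‖ : ℂ)⁻¹) • w) (s := {0}) (by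
          constructor
          · intro i
            simp [norm_smul, hw1]
          · intro i j hij
            exact absurd (Subsingleton.elim i j) hij)
      refine ⟨b, fun z => ?_⟩
      rw [b.repr_apply_apply, hb 0 rfl, inner_smul_left]
      simp [hne]
  set G : EuclideanSpace ℂ (Fin (m + 1)) → ℝ≥0∞ := fun z => posPow γ (1 - ‖z‖ ^ 2)
        * ENNReal.ofReal (‖1 - (‖w‖ : ℂ) * z 0‖ ^ (-κ)) with hG
  have hGm : Measurable G := by
    have h1 : Measurable fun z : EuclideanSpace ℂ (Fin (m + 1)) => z 0 :=
      (by fun_prop : Continuous fun z : EuclideanSpace ℂ (Fin (m + 1)) => z 0).measurable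
    fun_prop
  have hmp := LinearIsometryEquiv.measurePreserving
    ({ b.repr.toLinearEquiv.restrictScalars ℝ with norm_map' := b.repr.norm_map' } :
      EuclideanSpace ℂ (Fin (m + 1)) ≃ₗᵢ[ℝ] EuclideanSpace ℂ (Fin (m + 1)))
  calc _ = ∫⁻ z, G (b.repr z) := by
        refine lintegral_congr fun z => ?_
        simp only [hG, hb, b.repr.norm_map]
    _ = ∫⁻ z, G z := hmp.lintegral_comp hGm
    _ = c * ∫⁻ z : Fin (m + 1) → ℂ, G (WithLp.toLp 2 z) := hvol G hGm
    _ ≤ c * C := by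
        gcongr
        refine le_trans (le_of_eq ?_) (h ‖w‖ (norm_nonneg _) hw)
        refine lintegral_congr fun z => ?_
        simp only [hG, EuclideanSpace.norm_sq_eq]

/-! ### The measures of the weighted Bergman spaces -/

lemma lintegral_rawBallMeasure {n : ℕ} {γ : ℝ} (F : EuclideanSpace ℂ (Fin n) → ℝ≥0∞) :
    ∫⁻ z, F z ∂(rawBallMeasure n γ) = ∫⁻ z, posPow γ (1 - ‖z‖ ^ 2) * F z := by
  have hB : MeasurableSet (unitBall n) := Metric.isOpen_ball.measurableSet
  rw [rawBallMeasure, lintegral_withDensity_eq_lintegral_mul_non_measurable _ (by fun_prop)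
    (Filter.Eventually.of_forall fun _ => ENNReal.ofReal_lt_top), ← lintegral_indicator hB]
  refine lintegral_congr fun z => ?_
  by_cases hz : z ∈ unitBall n
  · rw [Set.indicator_of_mem hz, posPow_of_pos]
    · rfl
    · have : ‖z‖ < 1 := by simpa [unitBall] using hz
      nlinarith [norm_nonneg z]
  · rw [Set.indicator_of_notMem hz, posPow_of_nonpos, zero_mul]
    have : 1 ≤ ‖z‖ := by simpa [unitBall] using hz
    nlinarith

lemma rawBallMeasure_univ_ne_zero (n : ℕ) (γ : ℝ) : rawBallMeasure n γ Set.univ ≠ 0 := by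
  intro h
  have hB : MeasurableSet (unitBall n) := Metric.isOpen_ball.measurableSet
  rw [Measure.measure_univ_eq_zero, rawBallMeasure, withDensity_eq_zero_iff (by fun_prop)] at h
  have h2 := (ae_restrict_iff' hB).1 h
  have h3 : ∀ᵐ z : EuclideanSpace ℂ (Fin n), z ∉ unitBall n := by
    filter_upwards [h2] with z hz hzB
    have h4 : ‖z‖ < 1 := by simpa [unitBall] using hzB
    have h5 : 0 < 1 - ‖z‖ ^ 2 := by nlinarith [norm_nonneg z]
    have := hz hzB
    simp only [Pi.zero_apply, ENNReal.ofReal_eq_zero] at this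
    linarith [Real.rpow_pos_of_pos h5 γ]
  have h6 : volume (unitBall n) = 0 := by simpa [ae_iff] using h3
  exact (Metric.measure_ball_pos volume (0 : EuclideanSpace ℂ (Fin n)) one_pos).ne' h6

lemma rawBallMeasure_univ_ne_top {n : ℕ} (hn : 1 ≤ n) {γ : ℝ} (hγ : -1 < γ) :
    rawBallMeasure n γ Set.univ ≠ ⊤ := by
  obtain ⟨C, hC, h⟩ := exists_forelliRudin_bound hn (κ := 0) hγ (by
    have : (0 : ℝ) ≤ n := by positivity
    linarith)
  rw [← lintegral_one, lintegral_rawBallMeasure]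
  exact ne_top_of_le_ne_top hC (by simpa using h 0 (by simp))

lemma isProbabilityMeasure_ballMeasure {n : ℕ} (hn : 1 ≤ n) {γ : ℝ} (hγ : -1 < γ) :
    IsProbabilityMeasure (ballMeasure n γ) :=
  ⟨by rw [ballMeasure, Measure.smul_apply, smul_eq_mul,
    ENNReal.inv_mul_cancel (rawBallMeasure_univ_ne_zero n γ) (rawBallMeasure_univ_ne_top hn hγ)]⟩

lemma lintegral_ballMeasure {n : ℕ} {γ : ℝ} (F : EuclideanSpace ℂ (Fin n) → ℝ≥0∞) :
    ∫⁻ z, F z ∂(ballMeasure n γ) = (rawBallMeasure n γ Set.univ)⁻¹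
      * ∫⁻ z, posPow γ (1 - ‖z‖ ^ 2) * F z := by
  rw [ballMeasure, lintegral_smul_measure, lintegral_rawBallMeasure, smul_eq_mul]

lemma ae_mem_unitBall (n : ℕ) (γ : ℝ) : ∀ᵐ z ∂(ballMeasure n γ), z ∈ unitBall n := by
  have hB : MeasurableSet (unitBall n) := Metric.isOpen_ball.measurableSet
  refine Measure.ae_smul_measure ?_ _
  exact (withDensity_absolutelyContinuous _ _).ae_le (ae_restrict_mem hB)


/-! ### The geometry of `SU(n,1)` -/

section Geometry

variable {n : ℕ}

lemma conjTranspose_mul_J_mul (x : SU n) : (x.1.1)ᴴ * J n * x.1.1 = J n := x.2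

lemma J_mul_J (n : ℕ) : J n * J n = 1 := by
  simp [J, Matrix.fromBlocks_multiply]

lemma coe_inv_eq (x : SU n) : (x⁻¹).1.1 = J n * (x.1.1)ᴴ * J n := by
  have h1 : (J n * (x.1.1)ᴴ * J n) * x.1.1 = 1 := by
    rw [Matrix.mul_assoc, Matrix.mul_assoc, ← Matrix.mul_assoc _ (J n), conjTranspose_mul_J_mul,
      J_mul_J]
  have h2 : x.1.1 * (x⁻¹).1.1 = 1 := by
    have : x.1 * (x⁻¹).1 = 1 := by simp
    rw [← Matrix.SpecialLinearGroup.coe_mul, this, Matrix.SpecialLinearGroup.coe_one]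
  exact (left_inv_eq_right_inv h1 h2).symm

lemma blockD_inv (x : SU n) : blockD x⁻¹ = star (blockD x) := by
  rw [blockD, coe_inv_eq]
  simp [blockD, J, Matrix.mul_apply, Matrix.fromBlocks, Fintype.sum_sum_type]

lemma blockB_inv (x : SU n) (i : Fin n) : blockB x⁻¹ i = -star (blockC x i) := by
  rw [blockB, coe_inv_eq]
  simp [blockC, J, Matrix.mul_apply, Matrix.fromBlocks, Fintype.sum_sum_type,
    Matrix.one_apply]

lemma norm_blockD_inv (x : SU n) : ‖blockD x⁻¹‖ = ‖blockD x‖ := by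
  rw [blockD_inv, norm_star]

/-- The form `|v₀|² - |v'|²` of signature `(1,n)` on `ℂⁿ⁺¹`. -/
noncomputable def lorentz (v : Fin n ⊕ Unit → ℂ) : ℝ :=
  ‖v (Sum.inr ())‖ ^ 2 - ∑ i, ‖v (Sum.inl i)‖ ^ 2

lemma star_dotProduct_J_mulVec (v : Fin n ⊕ Unit → ℂ) :
    star v ⬝ᵥ (J n *ᵥ v) = (lorentz v : ℂ) := by
  have h : ∀ z : ℂ, (starRingEnd ℂ) z * z = ((‖z‖ : ℂ)) ^ 2 := fun z => by
    rw [mul_comm, Complex.mul_conj, Complex.normSq_eq_norm_sq]; push_cast; rfl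
  simp [lorentz, J, Matrix.mulVec, dotProduct, Fintype.sum_sum_type, Matrix.fromBlocks,
    Matrix.one_apply, h]
  ring

/-- The linear action of `SU(n,1)` on `ℂⁿ⁺¹`, of which `act` is the projectivization. -/
noncomputable def linAct (x : SU n) (v : Fin n ⊕ Unit → ℂ) : Fin n ⊕ Unit → ℂ := x.1.1 *ᵥ v

lemma lorentz_linAct (x : SU n) (v : Fin n ⊕ Unit → ℂ) : lorentz (linAct x v) = lorentz v := by
  have : ((lorentz (linAct x v) : ℝ) : ℂ) = (lorentz v : ℝ) := by
    rw [← star_dotProduct_J_mulVec, ← star_dotProduct_J_mulVec, linAct, Matrix.star_mulVec,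
      Matrix.mulVec_mulVec, ← Matrix.dotProduct_mulVec, Matrix.mulVec_mulVec, ← Matrix.mul_assoc,
      conjTranspose_mul_J_mul]
  exact_mod_cast this

lemma linAct_inr (x : SU n) (v : Fin n ⊕ Unit → ℂ) :
    (linAct x v) (Sum.inr ()) = ∑ j, blockC x j * v (Sum.inl j) + blockD x * v (Sum.inr ()) := by
  simp [linAct, Matrix.mulVec, dotProduct, Fintype.sum_sum_type, blockC, blockD]

lemma linAct_inl (x : SU n) (v : Fin n ⊕ Unit → ℂ) (i : Fin n) :
    (linAct x v) (Sum.inl i)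
      = ∑ j, blockA x i j * v (Sum.inl j) + blockB x i * v (Sum.inr ()) := by
  simp [linAct, Matrix.mulVec, dotProduct, Fintype.sum_sum_type, blockA, blockB]

lemma sum_norm_sq_blockB (x : SU n) : ∑ i, ‖blockB x i‖ ^ 2 = ‖blockD x‖ ^ 2 - 1 := by
  have h := lorentz_linAct x (Sum.elim 0 1)
  simp only [lorentz, linAct_inr, linAct_inl] at h
  simp at h
  linarith

lemma sum_norm_sq_blockC (x : SU n) : ∑ i, ‖blockC x i‖ ^ 2 = ‖blockD x‖ ^ 2 - 1 := by
  have h := sum_norm_sq_blockB x⁻¹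
  simpa only [blockB_inv, norm_neg, norm_star, norm_blockD_inv] using h

lemma one_le_norm_blockD (x : SU n) : 1 ≤ ‖blockD x‖ := by
  have h : 0 ≤ ∑ i, ‖blockB x i‖ ^ 2 := Finset.sum_nonneg fun i _ => by positivity
  rw [sum_norm_sq_blockB] at h
  nlinarith [norm_nonneg (blockD x)]

lemma norm_blockD_pos (x : SU n) : 0 < ‖blockD x‖ := one_pos.trans_le (one_le_norm_blockD x)

lemma blockD_ne_zero (x : SU n) : blockD x ≠ 0 := norm_pos_iff.1 (norm_blockD_pos x)

lemma one_sub_norm_act_zero_sq (x : SU n) : 1 - ‖act x 0‖ ^ 2 = (‖blockD x‖ ^ 2)⁻¹ := by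
  have h : ‖act x 0‖ ^ 2 = (∑ i, ‖blockB x i‖ ^ 2) * (‖blockD x‖ ^ 2)⁻¹ := by
    simp [EuclideanSpace.norm_sq_eq, act, mul_pow, Finset.sum_mul]
  have := norm_blockD_pos x
  rw [h, sum_norm_sq_blockB]
  field_simp
  ring

/-- The weight `(1 - |x · 0|²) ^ β` is the power `|d| ^ (-2β)`. -/
lemma one_sub_norm_act_zero_rpow (x : SU n) (β : ℝ) :
    (1 - ‖act x 0‖ ^ 2) ^ β = ‖blockD x‖ ^ (-2 * β) := by
  have := norm_blockD_pos x
  rw [one_sub_norm_act_zero_sq, ← Real.rpow_natCast, ← Real.rpow_neg this.le,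
    ← Real.rpow_mul this.le]
  norm_num

lemma norm_sum_mul_le (c z : Fin n → ℂ) :
    ‖∑ j, c j * z j‖ ≤ √(∑ j, ‖c j‖ ^ 2) * √(∑ j, ‖z j‖ ^ 2) := by
  calc ‖∑ j, c j * z j‖ ≤ ∑ j, ‖c j‖ * ‖z j‖ := (norm_sum_le _ _).trans (by simp)
    _ ≤ _ := Real.sum_mul_le_sqrt_mul_sqrt _ _ _

/-- The action preserves the ball: this is the invariance of the form at the vector `(z, 1)`. -/
lemma act_mem_unitBall (x : SU n) {z : EuclideanSpace ℂ (Fin n)} (hz : z ∈ unitBall n) :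
    act x z ∈ unitBall n := by
  have hz1 : ‖z‖ ^ 2 < 1 := by
    have : ‖z‖ < 1 := by simpa [unitBall] using hz
    nlinarith [norm_nonneg z]
  set v : Fin n ⊕ Unit → ℂ := Sum.elim z 1
  have h := lorentz_linAct x v
  have hv : lorentz v = 1 - ‖z‖ ^ 2 := by
    simp [lorentz, v, EuclideanSpace.norm_sq_eq]
  rw [hv] at h
  set D := (linAct x v) (Sum.inr ()) with hD
  have hact : ‖act x z‖ ^ 2 = (∑ i, ‖(linAct x v) (Sum.inl i)‖ ^ 2) * (‖D‖ ^ 2)⁻¹ := by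
    rw [hD]
    simp only [EuclideanSpace.norm_sq_eq, act, linAct_inl, linAct_inr, v, Sum.elim_inl,
      Sum.elim_inr, Pi.one_apply, mul_one, norm_mul, norm_inv, mul_pow, Finset.sum_mul, inv_pow]
  have hsum : 0 ≤ ∑ i, ‖(linAct x v) (Sum.inl i)‖ ^ 2 :=
    Finset.sum_nonneg fun i _ => by positivity
  have hlt : ∑ i, ‖(linAct x v) (Sum.inl i)‖ ^ 2 < ‖D‖ ^ 2 := by
    simp only [lorentz] at h
    linarith
  have : ‖act x z‖ ^ 2 < 1 := by
    rw [hact, ← div_eq_mul_inv, div_lt_one (hsum.trans_lt hlt)]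
    exact hlt
  have h3 : ‖act x z‖ < 1 := by nlinarith [norm_nonneg (act x z)]
  simpa [unitBall] using h3

/-! ### The topology of `SU(n,1)` -/

lemma continuous_coe_matrix : Continuous fun x : SU n => x.1.1 :=
  continuous_subtype_val.comp continuous_subtype_val

lemma continuous_linAct : Continuous fun q : SU n × (Fin n ⊕ Unit → ℂ) => linAct q.1 q.2 :=
  (continuous_coe_matrix.comp continuous_fst).matrix_mulVec continuous_snd

lemma continuous_linAct_inv :
    Continuous fun q : SU n × (Fin n ⊕ Unit → ℂ) => linAct q.1⁻¹ q.2 := by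
  have h : Continuous fun q : SU n × (Fin n ⊕ Unit → ℂ) => ((q.1⁻¹ : SU n), q.2) :=
    (continuous_inv.comp continuous_fst).prodMk continuous_snd
  exact Continuous.comp (f := fun q : SU n × (Fin n ⊕ Unit → ℂ) => ((q.1⁻¹ : SU n), q.2))
    continuous_linAct h

lemma continuous_entries : Continuous (entries : SU n → _) := by
  unfold entries
  refine continuous_pi fun i => continuous_pi fun j => ?_
  exact (continuous_apply j).comp ((continuous_apply i).comp continuous_coe_matrix)

lemma isClosedEmbedding_entries :
    IsClosedEmbedding (entries : SU n → (Fin n ⊕ Unit → Fin n ⊕ Unit → ℂ)) := by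
  have h1 : IsClosedEmbedding
      (Subtype.val : SU n → Matrix.SpecialLinearGroup (Fin n ⊕ Unit) ℂ) := by
    refine IsClosed.isClosedEmbedding_subtypeVal ?_
    have hc : Continuous fun x : Matrix.SpecialLinearGroup (Fin n ⊕ Unit) ℂ => x.1 :=
      continuous_subtype_val
    exact isClosed_eq (((hc.matrix_conjTranspose).matrix_mul continuous_const).matrix_mul hc)
      continuous_const
  exact Matrix.SpecialLinearGroup.isClosedEmbedding_val.comp h1

instance : SecondCountableTopology (SU n) :=
  isClosedEmbedding_entries.isEmbedding.secondCountableTopology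

instance : LocallyCompactSpace (SU n) := isClosedEmbedding_entries.locallyCompactSpace

instance : SigmaCompactSpace (SU n) := isClosedEmbedding_entries.sigmaCompactSpace

/-- The coefficient `d` dominates all entries, so it is a proper function on the group. -/
lemma norm_entries_le (x : SU n) : ‖entries x‖ ≤ ‖blockD x‖ := by
  have h0 := norm_blockD_pos x
  -- row `i` of `x J x* = J` bounds the block `A` by the block `b`
  have hA : ∀ i j, ‖blockA x i j‖ ≤ ‖blockD x‖ := by
    intro i j
    have h1 : x.1.1 * J n * (x.1.1)ᴴ = J n := by
      have h2 : x.1.1 * (x⁻¹).1.1 = 1 := by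
        have : x.1 * (x⁻¹).1 = 1 := by simp
        rw [← Matrix.SpecialLinearGroup.coe_mul, this, Matrix.SpecialLinearGroup.coe_one]
      rw [coe_inv_eq] at h2
      calc x.1.1 * J n * (x.1.1)ᴴ = x.1.1 * (J n * (x.1.1)ᴴ * J n) * J n := by
            simp only [Matrix.mul_assoc, J_mul_J, Matrix.mul_one]
        _ = J n := by rw [h2, Matrix.one_mul]
    have hc : ∀ z : ℂ, z * (starRingEnd ℂ) z = ((‖z‖ ^ 2 : ℝ) : ℂ) := fun z => by
      rw [Complex.mul_conj, Complex.normSq_eq_norm_sq]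
    have h2 := congrFun (congrFun h1 (Sum.inl i)) (Sum.inl i)
    simp [Matrix.mul_apply, Fintype.sum_sum_type, J, Matrix.fromBlocks, Matrix.one_apply, hc] at h2
    have h3 : -∑ k, ‖blockA x i k‖ ^ 2 + ‖blockB x i‖ ^ 2 = -1 := by
      simp only [blockA, blockB]
      exact_mod_cast h2
    have h4 : ‖blockA x i j‖ ^ 2 ≤ ∑ k, ‖blockA x i k‖ ^ 2 :=
      Finset.single_le_sum (f := fun k => ‖blockA x i k‖ ^ 2) (fun k _ => by positivity)
        (Finset.mem_univ j)
    have h5 : ‖blockB x i‖ ^ 2 ≤ ∑ k, ‖blockB x k‖ ^ 2 :=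
      Finset.single_le_sum (f := fun k => ‖blockB x k‖ ^ 2) (fun k _ => by positivity)
        (Finset.mem_univ i)
    rw [sum_norm_sq_blockB] at h5
    exact le_of_sq_le_sq (by linarith) h0.le
  have hB : ∀ i, ‖blockB x i‖ ≤ ‖blockD x‖ := by
    intro i
    have h5 : ‖blockB x i‖ ^ 2 ≤ ∑ k, ‖blockB x k‖ ^ 2 :=
      Finset.single_le_sum (f := fun k => ‖blockB x k‖ ^ 2) (fun k _ => by positivity)
        (Finset.mem_univ i)
    rw [sum_norm_sq_blockB] at h5
    exact le_of_sq_le_sq (by linarith) h0.le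
  have hC : ∀ i, ‖blockC x i‖ ≤ ‖blockD x‖ := by
    intro i
    have h5 : ‖blockC x i‖ ^ 2 ≤ ∑ k, ‖blockC x k‖ ^ 2 :=
      Finset.single_le_sum (f := fun k => ‖blockC x k‖ ^ 2) (fun k _ => by positivity)
        (Finset.mem_univ i)
    rw [sum_norm_sq_blockC] at h5
    exact le_of_sq_le_sq (by linarith) h0.le
  refine (pi_norm_le_iff_of_nonneg h0.le).2 fun i => (pi_norm_le_iff_of_nonneg h0.le).2 fun j => ?_
  rcases i with i | i <;> rcases j with j | j
  · exact hA i j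
  · exact hB i
  · exact hC j
  · exact le_rfl

@[fun_prop]
lemma continuous_blockA (i j : Fin n) : Continuous fun x : SU n => blockA x i j :=
  (continuous_apply (Sum.inl j)).comp ((continuous_apply (Sum.inl i)).comp continuous_entries)

@[fun_prop]
lemma continuous_blockB (i : Fin n) : Continuous fun x : SU n => blockB x i :=
  (continuous_apply (Sum.inr ())).comp ((continuous_apply (Sum.inl i)).comp continuous_entries)

@[fun_prop]
lemma continuous_blockC (i : Fin n) : Continuous fun x : SU n => blockC x i :=
  (continuous_apply (Sum.inl i)).comp ((continuous_apply (Sum.inr ())).comp continuous_entries)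

@[fun_prop]
lemma continuous_blockD : Continuous (blockD : SU n → ℂ) :=
  (continuous_apply (Sum.inr ())).comp ((continuous_apply (Sum.inr ())).comp continuous_entries)

lemma measure_norm_blockD_le_lt_top (μ : Measure (SU n)) [IsFiniteMeasureOnCompacts μ] (R : ℝ) :
    μ {x | ‖blockD x‖ ≤ R} < ⊤ := by
  have hK : IsCompact (entries ⁻¹' (Metric.closedBall 0 R) : Set (SU n)) :=
    isClosedEmbedding_entries.isCompact_preimage (isCompact_closedBall 0 R)
  refine (measure_mono fun x hx => ?_).trans_lt hK.measure_lt_top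
  simpa using (norm_entries_le x).trans hx

end Geometry


/-! ### From the group to the ball -/

section GroupIntegral

variable {n : ℕ}

lemma lintegral_sum_unit {F : (Fin n ⊕ Unit → ℂ) → ℝ≥0∞} (hF : Measurable F) :
    ∫⁻ v, F v = ∫⁻ ζ : ℂ, ∫⁻ z : Fin n → ℂ, F (Sum.elim z fun _ => ζ) := by
  have h1 := (volume_measurePreserving_sumPiEquivProdPi (fun _ : Fin n ⊕ Unit => ℂ)).symm
  have h2 := (volume_preserving_funUnique Unit ℂ).symm
  have hF1 : Measurable fun q => F ((MeasurableEquiv.sumPiEquivProdPi fun _ => ℂ).symm q) :=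
    hF.comp h1.measurable
  rw [← h1.lintegral_comp hF, Measure.volume_eq_prod,
    lintegral_prod_symm _ hF1.aemeasurable, ← h2.lintegral_comp]
  · refine lintegral_congr fun ζ => lintegral_congr fun z => congrArg F ?_
    ext i
    rcases i with i | i <;> rfl
  · exact Measurable.lintegral_prod_left hF1

lemma lintegral_pi_smul {F : (Fin n → ℂ) → ℝ≥0∞} (hF : Measurable F) {ζ : ℂ} (hζ : ζ ≠ 0) :
    ∫⁻ z, F z = ENNReal.ofReal (‖ζ‖ ^ (2 * n)) * ∫⁻ z, F (ζ • z) := by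
  have h := lintegral_comp_complexLinear volume (ζ • (LinearMap.id : (Fin n → ℂ) →ₗ[ℂ] _))
    (by simp [hζ]) hF
  rw [← h]
  simp [pow_mul, mul_comm]

/-- For fixed `z` in the ball and `A = 1 - |z|²`, the points `(ζ z, ζ)` of the shell form an annulus
in `ζ`; by scaling, a power integrates over it to a power of `A`. -/
lemma exists_annulus_bound (κ : ℝ) :
    ∃ C : ℝ≥0∞, C ≠ ⊤ ∧ ∀ A : ℝ,
      ∫⁻ ζ : ℂ, ((fun ζ : ℂ => ‖ζ‖ ^ 2 * A) ⁻¹' Set.Ioo 1 2).indicator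
        (fun ζ => ENNReal.ofReal (‖ζ‖ ^ κ)) ζ ≤ C * posPow (-κ / 2 - 1) A := by
  set F : ℝ → ℂ → ℝ≥0∞ := fun A => ((fun ζ : ℂ => ‖ζ‖ ^ 2 * A) ⁻¹' Set.Ioo 1 2).indicator
        (fun ζ => ENNReal.ofReal (‖ζ‖ ^ κ)) with hF
  have hFm : ∀ A, Measurable (F A) := fun A => Measurable.indicator (by fun_prop)
    ((by fun_prop : Measurable fun ζ : ℂ => ‖ζ‖ ^ 2 * A) measurableSet_Ioo)
  refine ⟨ENNReal.ofReal (2 ^ |κ|) * volume (Metric.ball (0 : ℂ) 2),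
    ENNReal.mul_ne_top ENNReal.ofReal_ne_top Metric.isBounded_ball.measure_lt_top.ne, fun A => ?_⟩
  have h1 : ∫⁻ ζ, F 1 ζ ≤ ENNReal.ofReal (2 ^ |κ|) * volume (Metric.ball (0 : ℂ) 2) := by
    rw [← setLIntegral_const, ← lintegral_indicator Metric.isOpen_ball.measurableSet]
    refine lintegral_mono fun ζ => ?_
    simp only [hF, mul_one]
    by_cases h : 1 < ‖ζ‖ ^ 2 ∧ ‖ζ‖ ^ 2 < 2
    · have hz1 : 1 ≤ ‖ζ‖ := by nlinarith [norm_nonneg ζ]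
      have hz2 : ‖ζ‖ < 2 := by nlinarith [norm_nonneg ζ]
      rw [Set.indicator_of_mem (by exact h), Set.indicator_of_mem (by simpa using hz2)]
      refine ENNReal.ofReal_le_ofReal ?_
      exact (Real.rpow_le_rpow_of_exponent_le hz1 (le_abs_self κ)).trans
        (Real.rpow_le_rpow (by linarith) hz2.le (abs_nonneg κ))
    · rw [Set.indicator_of_notMem (by exact h)]
      exact zero_le
  change ∫⁻ ζ, F A ζ ≤ _
  rcases le_or_gt A 0 with hA | hA
  · have : ∀ ζ, F A ζ = 0 := fun ζ => Set.indicator_of_notMem (by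
      rintro ⟨h, -⟩
      nlinarith [sq_nonneg ‖ζ‖, mul_nonneg (sq_nonneg ‖ζ‖) (neg_nonneg.2 hA)]) _
    simp [this]
  -- the substitution `ζ ↦ ζ / √A` reduces to `A = 1`
  have hs : 0 < (√A)⁻¹ := inv_pos.2 (Real.sqrt_pos.2 hA)
  have hs2 : (√A)⁻¹ ^ 2 = A⁻¹ := by rw [inv_pow, Real.sq_sqrt hA.le]
  let f : ℂ →ₗ[ℂ] ℂ := (((√A)⁻¹ : ℝ) : ℂ) • LinearMap.id
  have hdet : LinearMap.det f = (((√A)⁻¹ : ℝ) : ℂ) := by simp [f]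
  have hfn : ∀ ζ, ‖f ζ‖ = (√A)⁻¹ * ‖ζ‖ := fun ζ => by
    simp [f, abs_of_nonneg (Real.sqrt_nonneg A)]
  have hFf : ∀ ζ, F A (f ζ) = ENNReal.ofReal (A ^ (-κ / 2)) * F 1 ζ := by
    intro ζ
    classical
    have h2 : ‖f ζ‖ ^ 2 * A = ‖ζ‖ ^ 2 * 1 := by
      rw [hfn, mul_pow, hs2]; field_simp
    simp only [hF, Set.indicator_apply, Set.mem_preimage, h2]
    split_ifs
    · rw [hfn, Real.mul_rpow hs.le (norm_nonneg _), ENNReal.ofReal_mul (by positivity)]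
      congr 2
      rw [Real.sqrt_eq_rpow, ← Real.rpow_neg hA.le, ← Real.rpow_mul hA.le]
      congr 1; ring
    · simp
  rw [← lintegral_comp_complexLinear volume f (by rw [hdet]; exact_mod_cast hs.ne') (hFm A)]
  simp_rw [hFf]
  rw [lintegral_const_mul _ (hFm 1), hdet, Complex.norm_real, Real.norm_of_nonneg hs.le, hs2,
    posPow_of_pos hA, Real.rpow_sub_one hA.ne', ← mul_assoc,
    ← ENNReal.ofReal_mul (inv_pos.2 hA).le, mul_comm, div_eq_inv_mul]
  gcongr
  exact le_of_eq (div_eq_inv_mul _ _).symm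

/-- The set of `v` with `1 < |v₀|² - |v'|² < 2`, invariant under `SU(n,1)`. -/
def shell (n : ℕ) : Set (Fin n ⊕ Unit → ℂ) := lorentz ⁻¹' Set.Ioo 1 2

/-- A relatively compact part of the invariant shell. -/
def shellCore (n : ℕ) : Set (Fin n ⊕ Unit → ℂ) := shell n ∩ {v | ‖v (Sum.inr ())‖ < 2}

@[fun_prop]
lemma continuous_lorentz : Continuous (lorentz : (Fin n ⊕ Unit → ℂ) → ℝ) := by
  unfold lorentz; fun_prop

lemma isOpen_shell : IsOpen (shell n) :=
  isOpen_Ioo.preimage continuous_lorentz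

lemma isOpen_shellCore : IsOpen (shellCore n) :=
  isOpen_shell.inter (isOpen_lt (by fun_prop) continuous_const)

lemma volume_shellCore_ne_zero : volume (shellCore n) ≠ 0 := by
  refine (isOpen_shellCore.measure_pos volume ⟨Sum.elim 0 fun _ => ((5 / 4 : ℝ) : ℂ), ?_⟩).ne'
  simp only [shellCore, shell, lorentz, Set.mem_inter_iff, Set.mem_preimage, Set.mem_Ioo,
    Set.mem_ofPred_eq, Sum.elim_inr,
    Complex.norm_real, Sum.elim_inl, Pi.zero_apply, norm_zero]
  norm_num

lemma linAct_inr_bounds (g : SU n) {v : Fin n ⊕ Unit → ℂ} (hv : v ∈ shellCore n) :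
    ‖blockD g‖ / 4 ≤ ‖(linAct g v) (Sum.inr ())‖ ∧
      ‖(linAct g v) (Sum.inr ())‖ ≤ 4 * ‖blockD g‖ := by
  obtain ⟨⟨h1, -⟩, h2⟩ := hv
  simp only [lorentz] at h1
  simp only [Set.mem_ofPred_eq] at h2
  set a := √(∑ i, ‖v (Sum.inl i)‖ ^ 2) with ha
  have ha0 : 0 ≤ a := Real.sqrt_nonneg _
  have ha2 : ∑ i, ‖v (Sum.inl i)‖ ^ 2 = a ^ 2 :=
    (Real.sq_sqrt (Finset.sum_nonneg fun i _ => by positivity)).symm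
  set b := ‖v (Sum.inr ())‖ with hb
  have hb0 : 0 ≤ b := norm_nonneg _
  have hd := norm_blockD_pos g
  have hc : √(∑ j, ‖blockC g j‖ ^ 2) ≤ ‖blockD g‖ := by
    rw [sum_norm_sq_blockC]
    exact Real.sqrt_le_iff.2 ⟨hd.le, by linarith⟩
  have hs : ‖∑ j, blockC g j * v (Sum.inl j)‖ ≤ ‖blockD g‖ * a :=
    (norm_sum_mul_le _ fun j => v (Sum.inl j)).trans (mul_le_mul_of_nonneg_right hc ha0)
  have hm : ‖blockD g * v (Sum.inr ())‖ = ‖blockD g‖ * b := norm_mul _ _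
  rw [ha2] at h1
  have hab : a < b := by nlinarith
  have hq : 1 / 4 ≤ b - a := by nlinarith
  rw [linAct_inr]
  constructor
  · have h3 := norm_sub_le_norm_add (blockD g * v (Sum.inr ()))
      (∑ j, blockC g j * v (Sum.inl j))
    rw [add_comm]
    nlinarith
  · have h3 := norm_add_le (∑ j, blockC g j * v (Sum.inl j)) (blockD g * v (Sum.inr ()))
    nlinarith

lemma rpow_le_of_comparable {m y κ : ℝ} (hm : 0 < m) (h1 : m / 4 ≤ y) (h2 : y ≤ 4 * m) :
    m ^ κ ≤ 4 ^ |κ| * y ^ κ := by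
  have hy : 0 < y := by linarith
  rcases le_total 0 κ with h | h
  · rw [abs_of_nonneg h, ← Real.mul_rpow (by norm_num) hy.le]
    exact Real.rpow_le_rpow hm.le (by linarith) h
  · rw [abs_of_nonpos h, Real.rpow_neg (by norm_num), ← Real.inv_rpow (by norm_num),
      ← Real.mul_rpow (by norm_num) hy.le]
    exact Real.rpow_le_rpow_of_nonpos (by positivity) (by linarith) h

lemma lintegral_comp_linAct (g : SU n) {F : (Fin n ⊕ Unit → ℂ) → ℝ≥0∞} (hF : Measurable F) :
    ∫⁻ v, F (linAct g v) = ∫⁻ v, F v := by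
  have hd : LinearMap.det (Matrix.toLin' g.1.1) = 1 := by
    rw [LinearMap.det_toLin', g.1.2]
  have h := lintegral_comp_complexLinear volume (Matrix.toLin' g.1.1) (by simp [hd]) hF
  rw [hd, norm_one, one_pow, ENNReal.ofReal_one, one_mul] at h
  exact h

lemma linAct_linAct (g h : SU n) (v : Fin n ⊕ Unit → ℂ) :
    linAct g (linAct h v) = linAct (g * h) v := by
  rw [linAct, linAct, Matrix.mulVec_mulVec]; rfl

/-- The elements moving the core into a given position form a set of bounded Haar measure: any two
of them differ by an element with `|d| ≤ 8`. -/
lemma measure_inv_linAct_mem_shellCore_le (μ : Measure (SU n)) [μ.IsMulLeftInvariant]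
    (v : Fin n ⊕ Unit → ℂ) :
    μ {g | linAct g⁻¹ v ∈ shellCore n} ≤ μ {g | ‖blockD g‖ ≤ 8} := by
  rcases Set.eq_empty_or_nonempty {g : SU n | linAct g⁻¹ v ∈ shellCore n} with h | ⟨g₀, h₀⟩
  · rw [h]; simp
  · rw [← measure_preimage_mul μ g₀⁻¹ {g | ‖blockD g‖ ≤ 8}]
    refine measure_mono fun g hg => ?_
    have h1 := (linAct_inr_bounds (g⁻¹ * g₀) h₀).1
    rw [linAct_linAct, mul_assoc, mul_inv_cancel, mul_one] at h1
    have h2 : ‖(linAct g⁻¹ v) (Sum.inr ())‖ < 2 := hg.2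
    have h3 : ‖blockD (g₀⁻¹ * g)‖ = ‖blockD (g⁻¹ * g₀)‖ := by
      rw [← norm_blockD_inv]; simp
    simp only [Set.mem_preimage, Set.mem_ofPred_eq, h3]
    linarith

lemma volume_shellCore_ne_top : volume (shellCore n) ≠ ⊤ := by
  refine ne_top_of_le_ne_top (Metric.isBounded_ball (x := (0 : Fin n ⊕ Unit → ℂ))
    (r := 3)).measure_lt_top.ne (measure_mono fun v hv => ?_)
  obtain ⟨⟨h1, -⟩, h2⟩ := hv
  simp only [lorentz] at h1
  simp only [Set.mem_ofPred_eq] at h2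
  rw [mem_ball_zero_iff, pi_norm_lt_iff (by norm_num)]
  rintro (i | i)
  · have h5 : ‖v (Sum.inl i)‖ ^ 2 ≤ ∑ k, ‖v (Sum.inl k)‖ ^ 2 :=
      Finset.single_le_sum (f := fun k => ‖v (Sum.inl k)‖ ^ 2) (fun k _ => by positivity)
        (Finset.mem_univ i)
    nlinarith [norm_nonneg (v (Sum.inl i)), norm_nonneg (v (Sum.inr ()))]
  · exact h2.trans (by norm_num)

/-- The indicator of the core, moved by a group element. -/
noncomputable def coreIndicator (g : SU n) (v : Fin n ⊕ Unit → ℂ) : ℝ≥0∞ :=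
  (shellCore n).indicator 1 (linAct g⁻¹ v)

lemma measurable_coreIndicator : Measurable (Function.uncurry (coreIndicator (n := n))) :=
  (measurable_one.indicator isOpen_shellCore.measurableSet).comp continuous_linAct_inv.measurable

lemma coreIndicator_linAct (g : SU n) (v : Fin n ⊕ Unit → ℂ) :
    coreIndicator g (linAct g v) = (shellCore n).indicator 1 v := by
  rw [coreIndicator, linAct_linAct, inv_mul_cancel]
  simp [linAct]

lemma coreIndicator_of_notMem (g : SU n) {v : Fin n ⊕ Unit → ℂ} (hv : v ∉ shell n) :
    coreIndicator g v = 0 := by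
  refine Set.indicator_of_notMem (fun h => hv ?_) _
  have := h.1
  simpa only [shell, Set.mem_preimage, lorentz_linAct] using this

lemma lintegral_coreIndicator_le (μ : Measure (SU n)) [μ.IsMulLeftInvariant]
    (v : Fin n ⊕ Unit → ℂ) : ∫⁻ g, coreIndicator g v ∂μ ≤ μ {g | ‖blockD g‖ ≤ 8} := by
  refine le_trans (le_of_eq ?_) (measure_inv_linAct_mem_shellCore_le μ v)
  have hgm : Measurable fun g : SU n => linAct g⁻¹ v :=
    Measurable.comp (f := fun g : SU n => (g, v)) continuous_linAct_inv.measurable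
      measurable_prodMk_right
  have hms : MeasurableSet {g : SU n | linAct g⁻¹ v ∈ shellCore n} :=
    hgm isOpen_shellCore.measurableSet
  rw [← lintegral_indicator_one hms]
  rfl

/-- Comparison of an integral over the group with an integral over the invariant shell, by
averaging over the core and using the invariance of Lebesgue measure under `SU(n,1)`. -/
lemma volume_shellCore_mul_lintegral_le (μ : Measure (SU n)) [μ.IsHaarMeasure]
    {F : SU n → ℝ≥0∞} (hFm : Measurable F) {Φ : (Fin n ⊕ Unit → ℂ) → ℝ≥0∞} (hΦm : Measurable Φ)
    (c : ℝ≥0∞) (hFΦ : ∀ g : SU n, ∀ v ∈ shellCore n, F g ≤ c * Φ (linAct g v)) :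
    volume (shellCore n) * ∫⁻ g, F g ∂μ ≤
      c * μ {g | ‖blockD g‖ ≤ 8} * ∫⁻ v, (shell n).indicator Φ v := by
  have hindm : Measurable ((shellCore n).indicator (1 : (Fin n ⊕ Unit → ℂ) → ℝ≥0∞)) :=
    measurable_one.indicator isOpen_shellCore.measurableSet
  have hHm : Measurable fun q : SU n × (Fin n ⊕ Unit → ℂ) =>
      c * (coreIndicator q.1 q.2 * Φ q.2) :=
    measurable_const.mul (measurable_coreIndicator.mul (hΦm.comp measurable_snd))
  calc volume (shellCore n) * ∫⁻ g, F g ∂μ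
      = ∫⁻ g, (∫⁻ v, (shellCore n).indicator 1 v * F g) ∂μ := by
        rw [← lintegral_const_mul _ hFm]
        refine lintegral_congr fun g => ?_
        rw [lintegral_mul_const _ hindm,
          lintegral_indicator_one isOpen_shellCore.measurableSet]
    _ ≤ ∫⁻ g, (∫⁻ v, c * (coreIndicator g (linAct g v) * Φ (linAct g v))) ∂μ := by
        refine lintegral_mono fun g => lintegral_mono fun v => ?_
        simp only [coreIndicator_linAct]
        by_cases hv : v ∈ shellCore n
        · simpa [hv] using hFΦ g v hv
        · simp [hv]
    _ = ∫⁻ g, (∫⁻ v, c * (coreIndicator g v * Φ v)) ∂μ := by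
        refine lintegral_congr fun g => ?_
        exact lintegral_comp_linAct g (F := fun v => c * (coreIndicator g v * Φ v))
          (Measurable.comp (f := fun v => (g, v)) hHm measurable_prodMk_left)
    _ = ∫⁻ v, (∫⁻ g, c * (coreIndicator g v * Φ v) ∂μ) := lintegral_lintegral_swap
        hHm.aemeasurable
    _ ≤ ∫⁻ v, c * μ {g | ‖blockD g‖ ≤ 8} * (shell n).indicator Φ v := by
        refine lintegral_mono fun v => ?_
        have hm1 : Measurable fun g : SU n => coreIndicator g v :=
          Measurable.comp (f := fun g : SU n => (g, v)) measurable_coreIndicator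
            measurable_prodMk_right
        simp only
        by_cases hv : v ∈ shell n
        · rw [Set.indicator_of_mem hv, lintegral_const_mul _ (hm1.mul_const (Φ v)),
            lintegral_mul_const _ hm1, mul_assoc]
          gcongr
          exact lintegral_coreIndicator_le μ v
        · simp [coreIndicator_of_notMem _ hv, hv]
    _ = _ := lintegral_const_mul _ (hΦm.indicator isOpen_shell.measurableSet)

lemma exists_lintegral_group_le (μ : Measure (SU n)) [μ.IsHaarMeasure] (τ κ : ℝ) :
    ∃ C : ℝ≥0∞, C ≠ ⊤ ∧ ∀ x : SU n,
      ∫⁻ g, ENNReal.ofReal (‖blockD g‖ ^ τ * ‖blockD (x * g)‖ ^ κ) ∂μ ≤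
        C * ∫⁻ v, (shell n).indicator (fun v => ENNReal.ofReal
          (‖v (Sum.inr ())‖ ^ τ * ‖linAct x v (Sum.inr ())‖ ^ κ)) v := by
  have hS := volume_shellCore_ne_zero (n := n)
  have hK := (measure_norm_blockD_le_lt_top μ 8).ne
  set c : ℝ≥0∞ := ENNReal.ofReal (4 ^ |τ| * 4 ^ |κ|) with hc
  refine ⟨(volume (shellCore n))⁻¹ * (c * μ {g | ‖blockD g‖ ≤ 8}),
    ENNReal.mul_ne_top (ENNReal.inv_ne_top.2 hS) (ENNReal.mul_ne_top ENNReal.ofReal_ne_top hK),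
    fun x => ?_⟩
  have hxm : Measurable fun v : Fin n ⊕ Unit → ℂ => linAct x v (Sum.inr ()) := by
    simp only [linAct_inr]; fun_prop
  have hd1 : Measurable fun g : SU n => blockD g := continuous_blockD.measurable
  have hd2 : Measurable fun g : SU n => blockD (x * g) :=
    (continuous_blockD.comp (continuous_const_mul x)).measurable
  have key := volume_shellCore_mul_lintegral_le μ
    (F := fun g => ENNReal.ofReal (‖blockD g‖ ^ τ * ‖blockD (x * g)‖ ^ κ)) (by fun_prop)
    (Φ := fun v => ENNReal.ofReal (‖v (Sum.inr ())‖ ^ τ * ‖linAct x v (Sum.inr ())‖ ^ κ))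
    (by fun_prop) c (by
      intro g v hv
      obtain ⟨h1, h2⟩ := linAct_inr_bounds g hv
      obtain ⟨h3, h4⟩ := linAct_inr_bounds (x * g) hv
      rw [← linAct_linAct] at h3 h4
      rw [hc, ← ENNReal.ofReal_mul (by positivity)]
      refine ENNReal.ofReal_le_ofReal ?_
      calc _ ≤ (4 ^ |τ| * ‖(linAct g v) (Sum.inr ())‖ ^ τ) *
            (4 ^ |κ| * ‖(linAct x (linAct g v)) (Sum.inr ())‖ ^ κ) :=
          mul_le_mul (rpow_le_of_comparable (norm_blockD_pos _) h1 h2)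
            (rpow_le_of_comparable (norm_blockD_pos _) h3 h4) (by positivity) (by positivity)
        _ = _ := by ring)
  rw [mul_assoc (volume (shellCore n))⁻¹]
  refine le_trans (le_of_eq ?_) (mul_le_mul_right key _)
  rw [← mul_assoc, ENNReal.inv_mul_cancel hS volume_shellCore_ne_top, one_mul]

/-- The integral over the shell in the coordinates `v = (ζ z, ζ)`. -/
lemma lintegral_shell_eq (x : SU n) (τ κ : ℝ) :
    ∫⁻ v, (shell n).indicator (fun v => ENNReal.ofReal
        (‖v (Sum.inr ())‖ ^ τ * ‖(linAct x v) (Sum.inr ())‖ ^ κ)) v =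
      ∫⁻ z : Fin n → ℂ, ENNReal.ofReal (‖∑ j, blockC x j * z j + blockD x‖ ^ κ) *
        ∫⁻ ζ : ℂ, ((fun ζ : ℂ => ‖ζ‖ ^ 2 * (1 - ∑ i, ‖z i‖ ^ 2)) ⁻¹' Set.Ioo 1 2).indicator
          (fun ζ => ENNReal.ofReal (‖ζ‖ ^ (2 * n + τ + κ))) ζ := by
  have hxm : Measurable fun v : Fin n ⊕ Unit → ℂ => (linAct x v) (Sum.inr ()) := by
    simp only [linAct_inr]; fun_prop
  have hm : Measurable ((shell n).indicator (fun v => ENNReal.ofReal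
        (‖v (Sum.inr ())‖ ^ τ * ‖(linAct x v) (Sum.inr ())‖ ^ κ))) :=
    Measurable.indicator (by fun_prop) isOpen_shell.measurableSet
  set E : ℂ → (Fin n → ℂ) → ℝ≥0∞ := fun ζ z =>
    ENNReal.ofReal (‖∑ j, blockC x j * z j + blockD x‖ ^ κ) *
      ((fun ζ : ℂ => ‖ζ‖ ^ 2 * (1 - ∑ i, ‖z i‖ ^ 2)) ⁻¹' Set.Ioo 1 2).indicator
          (fun ζ => ENNReal.ofReal (‖ζ‖ ^ (2 * n + τ + κ))) ζ with hE
  have hEm : Measurable (Function.uncurry E) := by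
    have hs : MeasurableSet ((fun q : ℂ × (Fin n → ℂ) => ‖q.1‖ ^ 2 * (1 - ∑ i, ‖q.2 i‖ ^ 2)) ⁻¹'
        Set.Ioo 1 2) :=
      (by fun_prop : Measurable fun q : ℂ × (Fin n → ℂ) => ‖q.1‖ ^ 2 * (1 - ∑ i, ‖q.2 i‖ ^ 2))
        measurableSet_Ioo
    have h2 : Measurable fun q : ℂ × (Fin n → ℂ) =>
        ENNReal.ofReal (‖q.1‖ ^ (2 * n + τ + κ)) := by fun_prop
    have h1 : Measurable fun q : ℂ × (Fin n → ℂ) =>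
        ENNReal.ofReal (‖∑ j, blockC x j * q.2 j + blockD x‖ ^ κ) := by fun_prop
    exact h1.mul (h2.indicator hs)
  have hne : ∀ᵐ ζ : ℂ, ζ ≠ 0 := by simp [ae_iff]
  rw [lintegral_sum_unit hm]
  calc _ = ∫⁻ ζ : ℂ, ∫⁻ z : Fin n → ℂ, E ζ z := by
        refine lintegral_congr_ae ?_
        filter_upwards [hne] with ζ hζ
        have hζ0 : 0 < ‖ζ‖ := norm_pos_iff.2 hζ
        have hmζ : Measurable fun z : Fin n → ℂ => (Sum.elim z fun _ => ζ : Fin n ⊕ Unit → ℂ) := by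
          refine measurable_pi_iff.2 fun i => ?_
          rcases i with i | i
          · exact measurable_pi_apply i
          · exact measurable_const
        have hmζ' : Measurable fun z : Fin n → ℂ => (shell n).indicator (fun v => ENNReal.ofReal
            (‖v (Sum.inr ())‖ ^ τ * ‖(linAct x v) (Sum.inr ())‖ ^ κ)) (Sum.elim z fun _ => ζ) :=
          hm.comp hmζ
        rw [lintegral_pi_smul hmζ' hζ, ← lintegral_const_mul']
        · refine lintegral_congr fun z => ?_
          have hl : lorentz (Sum.elim (ζ • z) fun _ => ζ) = ‖ζ‖ ^ 2 * (1 - ∑ i, ‖z i‖ ^ 2) := by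
            simp [lorentz, mul_pow, ← Finset.mul_sum]; ring
          have hx : (linAct x (Sum.elim (ζ • z) fun _ => ζ)) (Sum.inr ())
              = ζ * (∑ j, blockC x j * z j + blockD x) := by
            rw [linAct_inr]
            simp only [Sum.elim_inl, Sum.elim_inr, Pi.smul_apply, smul_eq_mul, mul_add,
              Finset.mul_sum]
            congr 1
            · exact Finset.sum_congr rfl fun j _ => by ring
            · ring
          classical
          simp only [hE, Set.indicator_apply, shell, Set.mem_preimage,
            hl, hx,
            Sum.elim_inr, norm_mul]
          split_ifs
          · rw [← ENNReal.ofReal_mul (by positivity), ← ENNReal.ofReal_mul (by positivity)]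
            congr 1
            rw [Real.mul_rpow (norm_nonneg _) (norm_nonneg _), Real.rpow_add hζ0,
              Real.rpow_add hζ0, show (2 * (n : ℝ)) = ((2 * n : ℕ) : ℝ) by push_cast; ring,
              Real.rpow_natCast]
            ring
          · simp
        · exact ENNReal.ofReal_ne_top
    _ = ∫⁻ z : Fin n → ℂ, ∫⁻ ζ : ℂ, E ζ z := lintegral_lintegral_swap hEm.aemeasurable
    _ = _ := lintegral_congr fun z => lintegral_const_mul' _ _ ENNReal.ofReal_ne_top

/-- The basic integral estimate on the group: up to a constant, convolution with `|d| ^ (-τ)` maps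
`|d| ^ (-2t)` below itself as long as `n - τ/2 < t < τ/2`. The lower bound on `t` makes the weight
`(1 - |z|²) ^ γ` integrable, the upper bound makes the Forelli–Rudin estimate uniform. -/
theorem exists_lintegral_blockD_le (hn : 1 ≤ n) (μ : Measure (SU n)) [μ.IsHaarMeasure]
    {τ t : ℝ} (h1 : n - τ / 2 < t) (h2 : t < τ / 2) :
    ∃ C : ℝ≥0∞, C ≠ ⊤ ∧ ∀ x : SU n,
      ∫⁻ g, ENNReal.ofReal (‖blockD g‖ ^ (-τ) * ‖blockD (x * g)‖ ^ (-2 * t)) ∂μ ≤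
        C * ENNReal.ofReal (‖blockD x‖ ^ (-2 * t)) := by
  set γ : ℝ := τ / 2 + t - n - 1 with hγ
  obtain ⟨C1, hC1, hg⟩ := exists_lintegral_group_le μ (-τ) (-2 * t)
  obtain ⟨C2, hC2, ha⟩ := exists_annulus_bound (2 * n + -τ + -2 * t)
  obtain ⟨C3, hC3, hf⟩ := exists_forelliRudin_bound hn (γ := γ) (κ := 2 * t) (by linarith)
    (by linarith)
  obtain ⟨c, hc0, hc, hvol⟩ := exists_volume_euclideanSpace_eq n
  refine ⟨C1 * (C2 * (c⁻¹ * C3)), ENNReal.mul_ne_top hC1 (ENNReal.mul_ne_top hC2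
    (ENNReal.mul_ne_top (ENNReal.inv_ne_top.2 hc0) hC3)), fun x => ?_⟩
  have hd := norm_blockD_pos x
  set w : EuclideanSpace ℂ (Fin n) := WithLp.toLp 2 fun i => -star (blockC x i / blockD x) with hw
  have hw1 : ‖w‖ < 1 := by
    have : ‖w‖ ^ 2 = (‖blockD x‖ ^ 2 - 1) / ‖blockD x‖ ^ 2 := by
      rw [← sum_norm_sq_blockC, EuclideanSpace.norm_sq_eq, Finset.sum_div]
      simp [hw, div_pow]
    have h3 : ‖w‖ ^ 2 < 1 := by
      rw [this, div_lt_one (by positivity)]; linarith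
    nlinarith [norm_nonneg w]
  have hin : ∀ z : Fin n → ℂ, ∑ j, blockC x j * z j + blockD x
      = blockD x * (1 - inner ℂ w (WithLp.toLp 2 z)) := by
    intro z
    have : inner ℂ w (WithLp.toLp 2 z) = -((∑ j, blockC x j * z j) / blockD x) := by
      rw [PiLp.inner_apply, Finset.sum_div, ← Finset.sum_neg_distrib]
      refine Finset.sum_congr rfl fun i _ => ?_
      simp [hw]
      ring
    rw [this]
    have := blockD_ne_zero x
    field_simp
    ring
  refine (hg x).trans ?_
  rw [mul_assoc]
  gcongr
  rw [lintegral_shell_eq]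
  set F : EuclideanSpace ℂ (Fin n) → ℝ≥0∞ := fun z => posPow γ (1 - ‖z‖ ^ 2)
        * ENNReal.ofReal (‖1 - inner ℂ w z‖ ^ (-(2 * t))) with hF
  have hFm : Measurable F := by fun_prop
  calc _ ≤ ∫⁻ z : Fin n → ℂ, (C2 * ENNReal.ofReal (‖blockD x‖ ^ (-2 * t))) *
        F (WithLp.toLp 2 z) := by
        refine lintegral_mono fun z => ?_
        refine (mul_le_mul_right (ha _) _).trans (le_of_eq ?_)
        rw [hin, norm_mul, Real.mul_rpow (norm_nonneg _) (norm_nonneg _),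
          ENNReal.ofReal_mul (by positivity)]
        simp only [hF, EuclideanSpace.norm_sq_eq]
        rw [show -(2 * (n : ℝ) + -τ + -2 * t) / 2 - 1 = γ by rw [hγ]; ring,
          show -(2 * t) = -2 * t by ring]
        ring
    _ = C2 * ENNReal.ofReal (‖blockD x‖ ^ (-2 * t)) * (c⁻¹ * ∫⁻ z, F z) := by
        rw [lintegral_const_mul' _ _ (ENNReal.mul_ne_top hC2 ENNReal.ofReal_ne_top), hvol F hFm,
          ← mul_assoc c⁻¹, ENNReal.inv_mul_cancel hc0 hc, one_mul]
    _ ≤ C2 * ENNReal.ofReal (‖blockD x‖ ^ (-2 * t)) * (c⁻¹ * C3) := by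
        gcongr
        exact hf w hw1
    _ = _ := by ring

end GroupIntegral


/-! ### Integral operators: the Schur test -/

section Schur

variable {X : Type*} [MeasurableSpace X]

/-- Jensen's inequality for the measure with density `φ k`, applied to `f / φ`. -/
lemma lintegral_mul_rpow_le (μ : Measure X) {P : ℝ} (hP : 1 ≤ P) {f φ k : X → ℝ≥0∞}
    (hf : Measurable f) (hφ : Measurable φ) (hk : Measurable k) (h0 : ∀ y, φ y ≠ 0)
    (ht : ∀ y, φ y ≠ ⊤) :
    (∫⁻ y, f y * k y ∂μ) ^ P ≤
      (∫⁻ y, φ y * k y * (f y / φ y) ^ P ∂μ) * (∫⁻ y, k y * φ y ∂μ) ^ (P - 1) := by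
  have hP0 : 0 < P := by linarith
  have hφk : Measurable fun y => φ y * k y := hφ.mul hk
  set κ := μ.withDensity fun y => φ y * k y
  have hm : Measurable fun y => f y / φ y := hf.div hφ
  have h := eLpNorm'_le_eLpNorm'_mul_rpow_measure_univ (μ := κ) one_pos hP
    hm.aestronglyMeasurable
  have e1 : eLpNorm' (fun y => f y / φ y) 1 κ = ∫⁻ y, f y * k y ∂μ := by
    simp only [eLpNorm', enorm_eq_self, ENNReal.rpow_one, div_one]
    rw [lintegral_withDensity_eq_lintegral_mul _ hφk hm]
    refine lintegral_congr fun y => ?_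
    simp only [Pi.mul_apply]
    calc φ y * k y * (f y / φ y) = φ y * (f y / φ y) * k y := by ring
      _ = f y * k y := by rw [ENNReal.mul_div_cancel (h0 y) (ht y)]
  have e2 : eLpNorm' (fun y => f y / φ y) P κ
      = (∫⁻ y, φ y * k y * (f y / φ y) ^ P ∂μ) ^ (1 / P) := by
    simp only [eLpNorm', enorm_eq_self]
    rw [lintegral_withDensity_eq_lintegral_mul _ hφk (hm.pow_const P)]
    rfl
  have e3 : κ Set.univ = ∫⁻ y, k y * φ y ∂μ := by
    rw [withDensity_apply _ MeasurableSet.univ, Measure.restrict_univ]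
    simp only [mul_comm]
  rw [e1, e2, e3] at h
  refine (ENNReal.rpow_le_rpow h hP0.le).trans (le_of_eq ?_)
  rw [ENNReal.mul_rpow_of_nonneg _ _ hP0.le, ← ENNReal.rpow_mul, ← ENNReal.rpow_mul,
    one_div_mul_cancel hP0.ne', ENNReal.rpow_one]
  congr 2
  field_simp

/-- The Schur test on `L ^ P (ω dμ)` with test function `φ`. -/
theorem lintegral_lintegral_rpow_le (μ : Measure X) [SFinite μ] {P : ℝ} (hP : 1 ≤ P)
    {K : X → X → ℝ≥0∞} (hK : Measurable (Function.uncurry K)) {ω φ : X → ℝ≥0∞}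
    (hω : Measurable ω) (hφ : Measurable φ) (h0 : ∀ y, φ y ≠ 0) (ht : ∀ y, φ y ≠ ⊤) {A B : ℝ≥0∞}
    (h1 : ∀ x, ∫⁻ y, K x y * φ y ∂μ ≤ A * φ x)
    (h2 : ∀ y, ∫⁻ x, K x y * (ω x * φ x ^ (P - 1)) ∂μ ≤ B * (ω y * φ y ^ (P - 1)))
    {f : X → ℝ≥0∞} (hf : Measurable f) :
    ∫⁻ x, ω x * (∫⁻ y, f y * K x y ∂μ) ^ P ∂μ ≤
      A ^ (P - 1) * B * ∫⁻ y, ω y * f y ^ P ∂μ := by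
  have hP1 : 0 ≤ P - 1 := by linarith
  set g : X → ℝ≥0∞ := fun y => φ y * (f y / φ y) ^ P with hg
  have hgm : Measurable g := hφ.mul ((hf.div hφ).pow_const P)
  have hm : Measurable (Function.uncurry fun x y => g y * (K x y * (ω x * φ x ^ (P - 1)))) :=
    (hgm.comp measurable_snd).mul (hK.mul ((hω.mul (hφ.pow_const _)).comp measurable_fst))
  calc ∫⁻ x, ω x * (∫⁻ y, f y * K x y ∂μ) ^ P ∂μ
      ≤ ∫⁻ x, A ^ (P - 1) * ∫⁻ y, g y * (K x y * (ω x * φ x ^ (P - 1))) ∂μ ∂μ := by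
        refine lintegral_mono fun x => ?_
        have hKx : Measurable (K x) := hK.comp measurable_prodMk_left
        calc ω x * (∫⁻ y, f y * K x y ∂μ) ^ P
            ≤ ω x * ((∫⁻ y, φ y * K x y * (f y / φ y) ^ P ∂μ) * (A * φ x) ^ (P - 1)) := by
              gcongr
              refine (lintegral_mul_rpow_le μ hP hf hφ hKx h0 ht).trans ?_
              gcongr
              exact h1 x
          _ = A ^ (P - 1) * ((ω x * φ x ^ (P - 1)) *
                ∫⁻ y, φ y * K x y * (f y / φ y) ^ P ∂μ) := by
              rw [ENNReal.mul_rpow_of_nonneg _ _ hP1]; ring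
          _ = A ^ (P - 1) * ∫⁻ y, g y * (K x y * (ω x * φ x ^ (P - 1))) ∂μ := by
              rw [← lintegral_const_mul]
              · congr 1
                refine lintegral_congr fun y => ?_
                simp only [hg]; ring
              · exact (hφ.mul hKx).mul ((hf.div hφ).pow_const P)
    _ = A ^ (P - 1) * ∫⁻ y, ∫⁻ x, g y * (K x y * (ω x * φ x ^ (P - 1))) ∂μ ∂μ := by
        have hm' : Measurable fun x => ∫⁻ y, g y * (K x y * (ω x * φ x ^ (P - 1))) ∂μ :=
          hm.lintegral_prod_right'
        rw [lintegral_const_mul _ hm', lintegral_lintegral_swap hm.aemeasurable]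
    _ ≤ A ^ (P - 1) * ∫⁻ y, B * (ω y * f y ^ P) ∂μ := by
        gcongr with y
        have hKy : Measurable fun x => K x y := hK.comp measurable_prodMk_right
        rw [lintegral_const_mul _ (by fun_prop)]
        refine (mul_le_mul_right (h2 y) _).trans (le_of_eq ?_)
        have : φ y * φ y ^ (P - 1) * (f y / φ y) ^ P = f y ^ P := by
          rw [ENNReal.div_rpow_of_nonneg _ _ (by linarith)]
          nth_rw 1 [← ENNReal.rpow_one (φ y)]
          rw [← ENNReal.rpow_add _ _ (h0 y) (ht y), add_sub_cancel]
          refine ENNReal.mul_div_cancel ?_ ?_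
          · simp [ENNReal.rpow_eq_zero_iff, h0 y, ht y]
          · exact ENNReal.rpow_ne_top_of_nonneg (by linarith) (ht y)
        rw [← this, hg]
        ring
    _ = _ := by
        rw [lintegral_const_mul _ (by fun_prop), mul_assoc]

/-- A kernel satisfying a weighted `L ^ p` bound with absolute values defines a continuous linear
operator, given by absolutely convergent integrals. -/
theorem exists_clm_of_kernel_bound (μ : Measure X) [SFinite μ] {p : ℝ≥0∞} [Fact (1 ≤ p)]
    (hp : p ≠ ⊤) {ω : X → ℝ≥0∞} (hω : Measurable ω) (h0 : ∀ x, ω x ≠ 0)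
    {k : X → X → ℂ} (hk : Measurable (Function.uncurry k)) {C : ℝ≥0∞} (hC : C ≠ ⊤)
    (h : ∀ f : X → ℝ≥0∞, Measurable f →
      ∫⁻ x, ω x * (∫⁻ y, f y * ‖k x y‖ₑ ∂μ) ^ p.toReal ∂μ ≤
        C * ∫⁻ y, ω y * f y ^ p.toReal ∂μ) :
    ∃ T : Lp ℂ p (μ.withDensity ω) →L[ℂ] Lp ℂ p (μ.withDensity ω),
      ∀ f : Lp ℂ p (μ.withDensity ω), (∀ᵐ x ∂μ, Integrable (fun y => f y * k x y) μ) ∧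
        T f =ᵐ[μ] fun x => ∫ y, f y * k x y ∂μ := by
  set ν := μ.withDensity ω with hν
  have hp1 : 1 ≤ p := Fact.out
  have hp0 : p ≠ 0 := (one_pos.trans_le hp1).ne'
  have hP0 : 0 < p.toReal := ENNReal.toReal_pos hp0 hp
  have hμν : μ ≪ ν := withDensity_absolutelyContinuous' hω.aemeasurable
    (Filter.Eventually.of_forall h0)
  have hνμ : ν ≪ μ := withDensity_absolutelyContinuous μ ω
  have hlν : ∀ g : X → ℝ≥0∞, Measurable g → ∫⁻ x, g x ∂ν = ∫⁻ x, ω x * g x ∂μ := fun g hg =>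
    lintegral_withDensity_eq_lintegral_mul _ hω hg
  have hnorm : ∀ g : X → ℂ, Measurable g →
      eLpNorm g p ν = (∫⁻ x, ω x * ‖g x‖ₑ ^ p.toReal ∂μ) ^ (1 / p.toReal) := fun g hg => by
    rw [eLpNorm_eq_lintegral_rpow_enorm_toReal hp0 hp, hlν _ (hg.enorm.pow_const _)]
  have hfm : ∀ f : Lp ℂ p ν, Measurable f := fun f => (Lp.stronglyMeasurable f).measurable
  have hkx : ∀ x, Measurable (k x) := fun x => hk.comp measurable_prodMk_left
  set I : Lp ℂ p ν → X → ℝ≥0∞ := fun f x => ∫⁻ y, ‖f y‖ₑ * ‖k x y‖ₑ ∂μ with hI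
  have hjoint : ∀ f : Lp ℂ p ν, Measurable (Function.uncurry fun x y => f y * k x y) := fun f =>
    ((hfm f).comp measurable_snd).mul hk
  have hIm : ∀ f, Measurable (I f) := fun f => by
    have := (hjoint f).enorm
    simp only [Function.uncurry, enorm_mul] at this
    exact this.lintegral_prod_right'
  set S : Lp ℂ p ν → X → ℂ := fun f x => ∫ y, f y * k x y ∂μ with hS
  have hSm : ∀ f, Measurable (S f) := fun f =>
    (hjoint f).stronglyMeasurable.integral_prod_right.measurable
  have hSI : ∀ f x, ‖S f x‖ₑ ≤ I f x := fun f x =>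
    (enorm_integral_le_lintegral_enorm _).trans (le_of_eq (by simp only [enorm_mul, hI]))
  have hbound : ∀ f, ∫⁻ x, ω x * I f x ^ p.toReal ∂μ ≤ C * ∫⁻ y, ω y * ‖f y‖ₑ ^ p.toReal ∂μ :=
    fun f => h _ (hfm f).enorm
  have hfin : ∀ f : Lp ℂ p ν, ∫⁻ y, ω y * ‖f y‖ₑ ^ p.toReal ∂μ ≠ ⊤ := fun f hf => by
    have h1 := Lp.eLpNorm_ne_top f
    rw [hnorm f (hfm f), hf, ENNReal.top_rpow_of_pos (by positivity)] at h1
    exact h1 rfl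
  have hint : ∀ f : Lp ℂ p ν, ∀ᵐ x ∂μ, Integrable (fun y => f y * k x y) μ := fun f => by
    have h1 : ∫⁻ x, ω x * I f x ^ p.toReal ∂μ ≠ ⊤ :=
      ne_top_of_le_ne_top (ENNReal.mul_ne_top hC (hfin f)) (hbound f)
    filter_upwards [ae_lt_top (hω.mul ((hIm f).pow_const _)) h1] with x hx
    refine ⟨((hfm f).mul (hkx x)).aestronglyMeasurable, ?_⟩
    rw [HasFiniteIntegral]
    simp only [enorm_mul]
    have h2 : I f x ^ p.toReal ≠ ⊤ := fun h3 => by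
      simp only [Pi.mul_apply, h3] at hx
      rw [ENNReal.mul_top (h0 x)] at hx
      exact lt_irrefl _ hx
    rw [lt_top_iff_ne_top]
    intro h3
    apply h2
    simp only [hI, h3]
    exact ENNReal.top_rpow_of_pos hP0
  have hSnorm : ∀ f, eLpNorm (S f) p ν ≤ C ^ (1 / p.toReal) * eLpNorm f p ν := fun f => by
    rw [hnorm _ (hSm f), hnorm _ (hfm f), ← ENNReal.mul_rpow_of_nonneg _ _ (by positivity)]
    refine ENNReal.rpow_le_rpow (le_trans ?_ (hbound f)) (by positivity)
    gcongr with x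
    exact hSI f x
  have hCt : C ^ (1 / p.toReal) ≠ ⊤ := ENNReal.rpow_ne_top_of_nonneg (by positivity) hC
  have hmem : ∀ f, MemLp (S f) p ν := fun f => ⟨(hSm f).aestronglyMeasurable,
    (hSnorm f).trans_lt (ENNReal.mul_lt_top hCt.lt_top (Lp.eLpNorm_lt_top f))⟩
  have hadd : ∀ f g : Lp ℂ p ν, S (f + g) =ᵐ[μ] fun x => S f x + S g x := fun f g => by
    have h1 : (f + g : Lp ℂ p ν) =ᵐ[μ] f + g := hμν.ae_le (Lp.coeFn_add f g)
    filter_upwards [hint f, hint g] with x hx1 hx2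
    rw [hS, ← integral_add hx1 hx2]
    refine integral_congr_ae ?_
    filter_upwards [h1] with y hy
    rw [hy, Pi.add_apply, add_mul]
  have hsmul : ∀ (c : ℂ) (f : Lp ℂ p ν), S (c • f) = fun x => c * S f x := fun c f => by
    have h1 : (c • f : Lp ℂ p ν) =ᵐ[μ] c • ⇑f := hμν.ae_le (Lp.coeFn_smul c f)
    ext x
    rw [hS, ← integral_const_mul]
    refine integral_congr_ae ?_
    filter_upwards [h1] with y hy
    rw [hy, Pi.smul_apply, smul_eq_mul, mul_assoc]
  let T₀ : Lp ℂ p ν →ₗ[ℂ] Lp ℂ p ν :=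
    { toFun := fun f => (hmem f).toLp
      map_add' := fun f g => by
        refine Lp.ext ?_
        filter_upwards [(hmem (f + g)).coeFn_toLp, (hmem f).coeFn_toLp, (hmem g).coeFn_toLp,
          Lp.coeFn_add (hmem f).toLp (hmem g).toLp, hνμ.ae_le (hadd f g)] with x h1 h2 h3 h4 h5
        rw [h1, h4, Pi.add_apply, h2, h3, h5]
      map_smul' := fun c f => by
        refine Lp.ext ?_
        filter_upwards [(hmem (c • f)).coeFn_toLp, (hmem f).coeFn_toLp,
          Lp.coeFn_smul c (hmem f).toLp] with x h1 h2 h3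
        rw [h1, RingHom.id_apply, h3, Pi.smul_apply, h2, hsmul, smul_eq_mul] }
  refine ⟨T₀.mkContinuous (C ^ (1 / p.toReal)).toReal fun f => ?_, fun f => ⟨hint f, ?_⟩⟩
  · change ‖(hmem f).toLp‖ ≤ _
    rw [Lp.norm_toLp, Lp.norm_def, ← ENNReal.toReal_mul]
    exact ENNReal.toReal_mono (ENNReal.mul_ne_top hCt (Lp.eLpNorm_ne_top f)) (hSnorm f)
  · exact hμν.ae_le (hmem f).coeFn_toLp

end Schur


/-! ### Convolution with powers of the matrix coefficient `d` -/

section Convolution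

variable {n : ℕ}

lemma measurable_inv_mul : Measurable fun q : SU n × SU n => q.2⁻¹ * q.1 := by
  have h : Continuous fun q : SU n × SU n => q.2⁻¹ :=
    Continuous.comp (g := fun x : SU n => x⁻¹) (f := Prod.snd) continuous_inv continuous_snd
  exact (h.mul continuous_fst).measurable

/-- The decay kernel `|d(y⁻¹x)| ^ (-τ)`. -/
noncomputable def decayKernel (τ : ℝ) (x y : SU n) : ℝ≥0∞ :=
  ENNReal.ofReal (‖blockD (y⁻¹ * x)‖ ^ (-τ))

/-- The power `|d| ^ (-2t)`, that is `(1 - |x · 0|²) ^ t`. -/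
noncomputable def dPow (t : ℝ) (x : SU n) : ℝ≥0∞ := ENNReal.ofReal (‖blockD x‖ ^ (-2 * t))

lemma measurable_decayKernel (τ : ℝ) : Measurable (Function.uncurry (decayKernel (n := n) τ)) := by
  have h : Measurable fun q : SU n × SU n => blockD (q.2⁻¹ * q.1) :=
    Measurable.comp (g := blockD) continuous_blockD.measurable measurable_inv_mul
  exact (h.norm.pow_const (-τ)).ennreal_ofReal

@[fun_prop]
lemma measurable_dPow (t : ℝ) : Measurable (dPow (n := n) t) :=
  (continuous_blockD.measurable.norm.pow_const (-2 * t)).ennreal_ofReal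

lemma dPow_ne_zero (t : ℝ) (x : SU n) : dPow t x ≠ 0 :=
  (ENNReal.ofReal_pos.2 (Real.rpow_pos_of_pos (norm_blockD_pos x) _)).ne'

lemma dPow_ne_top (t : ℝ) (x : SU n) : dPow t x ≠ ⊤ := ENNReal.ofReal_ne_top

lemma dPow_mul_dPow_rpow (β t c : ℝ) (x : SU n) :
    dPow β x * dPow t x ^ c = dPow (β + t * c) x := by
  have h := norm_blockD_pos x
  rw [dPow, dPow, dPow, ENNReal.ofReal_rpow_of_pos (Real.rpow_pos_of_pos h _),
    ← ENNReal.ofReal_mul (by positivity), ← Real.rpow_mul h.le, ← Real.rpow_add h]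
  congr 2
  ring

lemma weighted_eq_withDensity_dPow (μ : Measure (SU n)) (β : ℝ) :
    weighted μ β = μ.withDensity (dPow β) := by
  unfold weighted dPow
  simp only [one_sub_norm_act_zero_rpow]

/-- Both marginal integrals of the decay kernel against `|d| ^ (-2t)` reduce to the same integral
on the group by a left translation. -/
lemma exists_decayKernel_bounds (hn : 1 ≤ n) (μ : Measure (SU n)) [μ.IsHaarMeasure] {τ t : ℝ}
    (h1 : n - τ / 2 < t) (h2 : t < τ / 2) :
    ∃ C : ℝ≥0∞, C ≠ ⊤ ∧ (∀ x : SU n, ∫⁻ y, decayKernel τ x y * dPow t y ∂μ ≤ C * dPow t x) ∧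
      ∀ y : SU n, ∫⁻ x, decayKernel τ x y * dPow t x ∂μ ≤ C * dPow t y := by
  obtain ⟨C, hC, h⟩ := exists_lintegral_blockD_le hn μ h1 h2
  refine ⟨C, hC, fun x => ?_, fun y => ?_⟩
  · rw [← lintegral_mul_left_eq_self _ x]
    refine le_trans (le_of_eq (lintegral_congr fun g => ?_)) (h x)
    rw [decayKernel, dPow, ← ENNReal.ofReal_mul (by positivity), mul_inv_rev, inv_mul_cancel_right,
      norm_blockD_inv]
  · rw [← lintegral_mul_left_eq_self _ y]
    refine le_trans (le_of_eq (lintegral_congr fun g => ?_)) (h y)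
    rw [decayKernel, dPow, ← ENNReal.ofReal_mul (by positivity), inv_mul_cancel_left]

/-- The range `-1 < α < p (s - n) - 1` is open, so a kernel decaying slightly slower than
`|d(y⁻¹x)| ^ (-s)` still passes the Schur test on the weighted space. -/
theorem exists_decay_exponent (hn : 1 ≤ n) {s α : ℝ} {p : ℝ≥0∞} [Fact (1 ≤ p)] (hp : p ≠ ⊤)
    (hα : -1 < α) (hα' : α < p.toReal * (s - n) - 1) (μ : Measure (SU n)) [μ.IsHaarMeasure] :
    ∃ τ < s, ∀ k : SU n → SU n → ℂ, Measurable (Function.uncurry k) →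
      (∃ C : ℝ, ∀ x y, ‖k x y‖ ≤ C * ‖blockD (y⁻¹ * x)‖ ^ (-τ)) →
      ∃ T : Lp ℂ p (weighted μ (α + n + 1 - s * p.toReal / 2)) →L[ℂ]
          Lp ℂ p (weighted μ (α + n + 1 - s * p.toReal / 2)),
        ∀ f : Lp ℂ p (weighted μ (α + n + 1 - s * p.toReal / 2)),
          (∀ᵐ x ∂μ, Integrable (fun y => f y * k x y) μ) ∧
          T f =ᵐ[μ] fun x => ∫ y, f y * k x y ∂μ := by
  set P := p.toReal with hPdef
  have hP : 1 ≤ P := by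
    have := ENNReal.toReal_mono hp (Fact.out : 1 ≤ p)
    simpa using this
  have hsn : 0 < s - n := by
    by_contra! h
    nlinarith
  have hsnP : 0 < (s - n) * P := by positivity
  set l := (α + 1) / ((s - n) * P) with hl
  have hl0 : 0 < l := div_pos (by linarith) hsnP
  have hl1 : l < 1 := by rw [hl, div_lt_one hsnP]; linarith
  have hlm : l * ((s - n) * P) = α + 1 := div_mul_cancel₀ _ hsnP.ne'
  set ε := min l (1 - l) * (s - n) / 2 with hε
  have hm0 : 0 < min l (1 - l) := lt_min hl0 (by linarith)
  have hε0 : 0 < ε := by positivity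
  have hεl : ε < l * (s - n) := by
    have : min l (1 - l) * (s - n) ≤ l * (s - n) :=
      mul_le_mul_of_nonneg_right (min_le_left _ _) hsn.le
    have : 0 < min l (1 - l) * (s - n) := by positivity
    rw [hε]; linarith
  have hεl' : ε < (1 - l) * (s - n) := by
    have : min l (1 - l) * (s - n) ≤ (1 - l) * (s - n) :=
      mul_le_mul_of_nonneg_right (min_le_right _ _) hsn.le
    have : 0 < min l (1 - l) * (s - n) := by positivity
    rw [hε]; linarith
  -- `t` is the exponent of the Schur test function and `t₁` that of the function in the dual
  -- condition, `t₁ = β + (P - 1) t`; both lie in the interval `(n - s/2, s/2)`, at the fractions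
  -- `1 - l` and `l`, hence the choice of `ε`
  set t := s / 2 - l * (s - n) with ht
  set t₁ := n - s / 2 + l * (s - n) with ht₁
  set β := α + n + 1 - s * P / 2 with hβ
  have hβt : β + t * (P - 1) = t₁ := by
    rw [hβ, ht, ht₁]
    linear_combination -hlm
  obtain ⟨A, hA, hA1, -⟩ := exists_decayKernel_bounds hn μ (τ := s - 2 * ε) (t := t)
    (by rw [ht]; linarith) (by rw [ht]; linarith)
  obtain ⟨B, hB, -, hB2⟩ := exists_decayKernel_bounds hn μ (τ := s - 2 * ε) (t := t₁)
    (by rw [ht₁]; linarith) (by rw [ht₁]; linarith)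
  refine ⟨s - 2 * ε, by linarith, fun k hk ⟨C, hC⟩ => ?_⟩
  rw [weighted_eq_withDensity_dPow]
  set c := ENNReal.ofReal C with hc
  have hK : Measurable (Function.uncurry fun x y : SU n => c * decayKernel (s - 2 * ε) x y) :=
    measurable_const.mul (measurable_decayKernel _)
  refine exists_clm_of_kernel_bound μ hp (measurable_dPow β) (dPow_ne_zero β) hk
    (C := (c * A) ^ (P - 1) * (c * B)) ?_ fun f hf => ?_
  · exact ENNReal.mul_ne_top (ENNReal.rpow_ne_top_of_nonneg (by linarith)
      (ENNReal.mul_ne_top ENNReal.ofReal_ne_top hA)) (ENNReal.mul_ne_top ENNReal.ofReal_ne_top hB)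
  · refine le_trans ?_ (lintegral_lintegral_rpow_le μ hP hK (measurable_dPow β) (measurable_dPow t)
      (dPow_ne_zero t) (dPow_ne_top t) (A := c * A) (B := c * B) (fun x => ?_) (fun y => ?_) hf)
    · gcongr with x y
      rw [hc, decayKernel, ← ENNReal.ofReal_mul' (by positivity), ← ofReal_norm]
      exact ENNReal.ofReal_le_ofReal (hC x y)
    · simp_rw [mul_assoc]
      rw [lintegral_const_mul' _ _ ENNReal.ofReal_ne_top]
      gcongr
      exact hA1 x
    · simp_rw [mul_assoc, dPow_mul_dPow_rpow, hβt]
      rw [lintegral_const_mul' _ _ ENNReal.ofReal_ne_top]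
      gcongr
      exact hB2 y

end Convolution


/-! ### Radial regularity of holomorphic functions on the disc -/

/-- The Euler operator `ζ d/dζ`. -/
noncomputable def euler (f : ℂ → ℂ) (ζ : ℂ) : ℂ := ζ * deriv f ζ

lemma differentiableOn_euler {f : ℂ → ℂ} (hf : DifferentiableOn ℂ f (Metric.ball 0 1)) :
    DifferentiableOn ℂ (euler f) (Metric.ball 0 1) :=
  differentiableOn_id.mul (hf.deriv Metric.isOpen_ball)

lemma differentiableOn_iterate_euler {f : ℂ → ℂ} (hf : DifferentiableOn ℂ f (Metric.ball 0 1))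
    (j : ℕ) : DifferentiableOn ℂ (euler^[j] f) (Metric.ball 0 1) := by
  induction j with
  | zero => exact hf
  | succ j ih =>
    rw [Function.iterate_succ_apply']
    exact differentiableOn_euler ih

/-- Integration of a bound on `ζ f'(ζ)` along a radius. -/
lemma norm_le_of_euler_le {f : ℂ → ℂ} (hf : DifferentiableOn ℂ f (Metric.ball 0 1))
    {C₀ C₁ e : ℝ} (he : e ≠ 1) (h0 : ∀ ζ, ‖ζ‖ ≤ 1 / 2 → ‖f ζ‖ ≤ C₀)
    (h1 : ∀ ζ, ‖ζ‖ < 1 → ‖euler f ζ‖ ≤ C₁ * (1 - ‖ζ‖) ^ (-e)) {ζ : ℂ} (hζ : 1 / 2 ≤ ‖ζ‖)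
    (hζ1 : ‖ζ‖ < 1) :
    ‖f ζ‖ ≤ C₀ + 2 * C₁ / (e - 1) * ((1 - ‖ζ‖) ^ (1 - e) - (1 / 2) ^ (1 - e)) := by
  set ρ := ‖ζ‖ with hρ
  have hρ0 : 0 < ρ := by linarith
  set ω : ℂ := ζ / (ρ : ℂ) with hω
  have hρc : (ρ : ℂ) ≠ 0 := by exact_mod_cast hρ0.ne'
  have hω1 : ‖ω‖ = 1 := by
    rw [hω, norm_div, Complex.norm_real, Real.norm_of_nonneg hρ0.le, ← hρ, div_self hρ0.ne']
  have hn : ∀ t : ℝ, 0 ≤ t → ‖(t : ℂ) * ω‖ = t := fun t ht => by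
    rw [norm_mul, hω1, mul_one, Complex.norm_real, Real.norm_of_nonneg ht]
  have hd : ∀ t : ℝ, 0 ≤ t → t < 1 →
      HasDerivAt (fun t : ℝ => f (t * ω)) (deriv f (t * ω) * ω) t := fun t ht ht1 => by
    have hm : (t : ℂ) * ω ∈ Metric.ball (0 : ℂ) 1 := by
      rw [mem_ball_zero_iff, hn t ht]; exact ht1
    have h2 : HasDerivAt f (deriv f (t * ω)) (t * ω) :=
      ((hf _ hm).differentiableAt (Metric.isOpen_ball.mem_nhds hm)).hasDerivAt
    have h3 : HasDerivAt (fun t : ℝ => (t : ℂ) * ω) ω t := by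
      simpa using (Complex.ofRealCLM.hasDerivAt (x := t)).mul_const ω
    exact h2.comp t h3
  set B : ℝ → ℝ := fun t => C₀ + 2 * C₁ / (e - 1) * ((1 - t) ^ (1 - e) - (1 / 2) ^ (1 - e)) with hB
  have hBd : ∀ t : ℝ, t < 1 → HasDerivAt B (2 * C₁ * (1 - t) ^ (-e)) t := fun t ht => by
    have h2 : HasDerivAt (fun t : ℝ => (1 - t) ^ (1 - e))
        (-1 * (1 - e) * (1 - t) ^ (1 - e - 1)) t :=
      ((hasDerivAt_id t).const_sub 1).rpow_const (Or.inl (by simp; linarith))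
    have h3 := ((h2.sub_const ((1 / 2 : ℝ) ^ (1 - e))).const_mul (2 * C₁ / (e - 1))).const_add C₀
    refine h3.congr_deriv ?_
    rw [show 1 - e - 1 = -e by ring]
    have : e - 1 ≠ 0 := sub_ne_zero.2 he
    field_simp
    ring
  have hmain := image_norm_le_of_norm_deriv_right_le_deriv_boundary' (f := fun t : ℝ => f (t * ω))
    (f' := fun t => deriv f (t * ω) * ω) (a := 1 / 2) (b := ρ) (B := B)
    (B' := fun t => 2 * C₁ * (1 - t) ^ (-e))
    (fun t ht => (hd t (by linarith [ht.1]) (by linarith [ht.2])).continuousAt.continuousWithinAt)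
    (fun t ht => (hd t (by linarith [ht.1]) (by linarith [ht.2])).hasDerivWithinAt)
    (by
      simp only [hB]
      rw [show (1 : ℝ) - 1 / 2 = 1 / 2 by norm_num, sub_self, mul_zero, add_zero]
      exact h0 _ (by rw [hn _ (by norm_num)]))
    (fun t ht => (hBd t (by linarith [ht.2])).continuousAt.continuousWithinAt)
    (fun t ht => (hBd t (by linarith [ht.2])).hasDerivWithinAt)
    (fun t ht => by
      have ht0 : 0 < t := by linarith [ht.1]
      have h2 := h1 (t * ω) (by rw [hn t ht0.le]; linarith [ht.2])
      rw [euler, norm_mul, hn t ht0.le] at h2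
      rw [norm_mul, hω1, mul_one]
      have h3 : 1 / 2 * ‖deriv f (t * ω)‖ ≤ t * ‖deriv f (t * ω)‖ :=
        mul_le_mul_of_nonneg_right ht.1 (norm_nonneg _)
      linarith)
    (Set.right_mem_Icc.2 hζ)
  have hζω : (ρ : ℂ) * ω = ζ := by rw [hω]; field_simp
  simp only [hζω] at hmain
  exact hmain

/-- If all iterates `(ζ d/dζ)^j f` grow at most like a fixed power of `1 / (1 - |ζ|)`, then `f` is
bounded, uniformly over all such `f`: each radial integration lowers the power by one. -/
lemma exists_bound_of_iterate_euler_le (k : ℕ) : ∀ C : ℕ → ℝ, ∃ K : ℝ, ∀ f : ℂ → ℂ,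
    DifferentiableOn ℂ f (Metric.ball 0 1) →
    (∀ j ζ, ‖ζ‖ < 1 → ‖euler^[j] f ζ‖ ≤ C j * (1 - ‖ζ‖) ^ (-((k : ℝ) + 1 / 2))) →
    ∀ ζ, ‖ζ‖ < 1 → ‖f ζ‖ ≤ K := by
  have hsmall : ∀ {c e : ℝ} {f : ℂ → ℂ}, 0 ≤ c → 0 ≤ e →
      (∀ ζ, ‖ζ‖ < 1 → ‖f ζ‖ ≤ c * (1 - ‖ζ‖) ^ (-e)) →
      ∀ ζ, ‖ζ‖ ≤ 1 / 2 → ‖f ζ‖ ≤ c * (1 / 2) ^ (-e) := by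
    intro c e f hc he h ζ hζ
    refine (h ζ (by linarith)).trans (mul_le_mul_of_nonneg_left ?_ hc)
    exact Real.rpow_le_rpow_of_nonpos (by norm_num) (by linarith) (by linarith)
  have hpos : ∀ {c e : ℝ} {f : ℂ → ℂ},
      (∀ ζ, ‖ζ‖ < 1 → ‖f ζ‖ ≤ c * (1 - ‖ζ‖) ^ (-e)) → 0 ≤ c := by
    intro c e f h
    have := (norm_nonneg _).trans (h 0 (by simp))
    simpa using this
  induction k with
  | zero =>
    intro C
    refine ⟨C 0 * (1 / 2) ^ (-(1 / 2 : ℝ)) + 4 * C 1, fun f hf h ζ hζ => ?_⟩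
    simp only [Nat.cast_zero, zero_add] at h
    have hC0 := hpos (h 0)
    have hC1 := hpos (h 1)
    have hs := hsmall hC0 (by norm_num) (h 0)
    rcases le_or_gt ‖ζ‖ (1 / 2) with h2 | h2
    · exact (hs ζ h2).trans (by linarith)
    · refine (norm_le_of_euler_le hf (e := 1 / 2) (by norm_num) hs (h 1) h2.le hζ).trans ?_
      have h3 : (1 / 2 : ℝ) ^ (1 - 1 / 2 : ℝ) ≤ 1 :=
        Real.rpow_le_one (by norm_num) (by norm_num) (by norm_num)
      have h4 : 0 ≤ (1 - ‖ζ‖) ^ (1 - 1 / 2 : ℝ) := Real.rpow_nonneg (by linarith) _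
      have h5 : 2 * C 1 / (1 / 2 - 1) = -(4 * C 1) := by ring
      rw [h5]
      nlinarith
  | succ k ih =>
    intro C
    obtain ⟨K, hK⟩ := ih fun j => C j * (1 / 2) ^ (-((k + 1 : ℕ) + 1 / 2 : ℝ)) + 4 * C (j + 1)
    refine ⟨K, fun f hf h => hK f hf fun j ζ hζ => ?_⟩
    have hC0 := hpos (h j)
    have hC1 := hpos (h (j + 1))
    have hs := hsmall hC0 (by positivity) (h j)
    have h1ζ : 0 < 1 - ‖ζ‖ := by linarith
    have hge : 1 ≤ (1 - ‖ζ‖) ^ (-((k : ℝ) + 1 / 2)) :=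
      Real.one_le_rpow_of_pos_of_le_one_of_nonpos h1ζ (by linarith [norm_nonneg ζ])
        (by have : (0 : ℝ) ≤ k := by positivity
            linarith)
    have hD0 : 0 ≤ C j * (1 / 2 : ℝ) ^ (-((k + 1 : ℕ) + 1 / 2 : ℝ)) := by positivity
    rcases le_or_gt ‖ζ‖ (1 / 2) with h2 | h2
    · refine (hs ζ h2).trans ?_
      nlinarith
    · have he : ((k + 1 : ℕ) + 1 / 2 : ℝ) - 1 = k + 1 / 2 := by push_cast; ring
      have hk0 : (0 : ℝ) ≤ k := by positivity
      have h6 := norm_le_of_euler_le (differentiableOn_iterate_euler hf j)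
        (e := ((k + 1 : ℕ) + 1 / 2 : ℝ))
        (by rw [← sub_ne_zero, he]; positivity) hs
        (fun ζ hζ => by
          have := h (j + 1) ζ hζ
          rwa [Function.iterate_succ_apply'] at this) h2.le hζ
      rw [he, show 1 - (((k + 1 : ℕ) : ℝ) + 1 / 2) = -((k : ℝ) + 1 / 2) by push_cast; ring] at h6
      refine h6.trans ?_
      have h7 : 2 * C (j + 1) / ((k : ℝ) + 1 / 2) ≤ 4 * C (j + 1) := by
        rw [div_le_iff₀ (by positivity)]; nlinarith
      have h8 : 0 ≤ 2 * C (j + 1) / ((k : ℝ) + 1 / 2) := by positivity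
      have h9 : 0 ≤ (1 / 2 : ℝ) ^ (-((k : ℝ) + 1 / 2)) := by positivity
      nlinarith [mul_nonneg h8 h9]

/-! ### The mean value property on balls of `ℂⁿ` -/

section MeanValue

variable {n : ℕ}

lemma integral_ball_comp_smul (u : EuclideanSpace ℂ (Fin n) → ℂ) (a : EuclideanSpace ℂ (Fin n))
    (r : ℝ) {c : ℂ} (hc : ‖c‖ = 1) :
    ∫ ζ in Metric.ball 0 r, u (a + c • ζ) = ∫ ζ in Metric.ball 0 r, u (a + ζ) := by
  have hc0 : c ≠ 0 := norm_ne_zero_iff.1 (by rw [hc]; exact one_ne_zero)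
  let e : EuclideanSpace ℂ (Fin n) ≃ₗᵢ[ℝ] EuclideanSpace ℂ (Fin n) :=
    { (LinearEquiv.smulOfNeZero ℂ (EuclideanSpace ℂ (Fin n)) c hc0).restrictScalars ℝ with
      norm_map' := fun v => by
        change ‖c • v‖ = ‖v‖
        rw [norm_smul, hc, one_mul] }
  have he := LinearIsometryEquiv.measurePreserving e
  have hpre : e ⁻¹' Metric.ball 0 r = Metric.ball 0 r := by
    ext v; simp
  have h := he.setIntegral_preimage_emb e.toHomeomorph.measurableEmbedding
    (fun ζ => u (a + ζ)) (Metric.ball 0 r)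
  rw [hpre] at h
  exact h

/-- The mean value property: rotating the variable and averaging over the circle reduces it to
one complex variable. -/
lemma integral_ball_eq_measure_mul {u : EuclideanSpace ℂ (Fin n) → ℂ}
    (hu : DifferentiableOn ℂ u (unitBall n)) {a : EuclideanSpace ℂ (Fin n)} {r : ℝ}
    (har : ‖a‖ + r < 1) :
    ∫ z in Metric.ball a r, u z = (volume (Metric.ball a r)).toReal * u a := by
  have hmem : ∀ ζ : EuclideanSpace ℂ (Fin n), ‖ζ‖ ≤ r → ∀ c : ℂ, ‖c‖ ≤ 1 →
      a + c • ζ ∈ unitBall n := by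
    intro ζ hζ c hc
    have h1 : ‖a + c • ζ‖ ≤ ‖a‖ + ‖c‖ * ‖ζ‖ := (norm_add_le _ _).trans (by rw [norm_smul])
    have h2 : ‖c‖ * ‖ζ‖ ≤ 1 * r := mul_le_mul hc hζ (norm_nonneg _) zero_le_one
    simp only [unitBall, mem_ball_zero_iff]
    linarith
  have htrans : ∫ z in Metric.ball a r, u z = ∫ ζ in Metric.ball 0 r, u (a + ζ) := by
    have h := (measurePreserving_add_left (volume : Measure (EuclideanSpace ℂ (Fin n)))
      a).setIntegral_preimage_emb (measurableEmbedding_addLeft a) u (Metric.ball a r)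
    rw [← h]
    congr 2
    ext v; simp
  have hvol : volume (Metric.ball a r) = volume (Metric.ball (0 : EuclideanSpace ℂ (Fin n)) r) :=
    Measure.addHaar_ball_center volume a r
  set I := ∫ ζ in Metric.ball 0 r, u (a + ζ) with hI
  have hpi := Real.pi_pos
  have hslice : ∀ ζ ∈ Metric.ball (0 : EuclideanSpace ℂ (Fin n)) r,
      ∫ θ in Set.Ioc 0 (2 * Real.pi), u (a + circleMap 0 1 θ • ζ) = (2 * Real.pi) * u a := by
    intro ζ hζ
    have hζ' : ‖ζ‖ ≤ r := by
      have : ‖ζ‖ < r := by simpa using hζ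
      exact this.le
    have hd : DifferentiableOn ℂ (fun c : ℂ => u (a + c • ζ)) (Metric.closedBall 0 1) := by
      refine hu.comp ?_ fun c hc => hmem ζ hζ' c (by simpa using hc)
      fun_prop
    have h := DiffContOnCl.circleAverage (f := fun c : ℂ => u (a + c • ζ)) (R := 1) (c := 0)
      (by
        rw [abs_one]
        exact DifferentiableOn.diffContOnCl (hd.mono Metric.closure_ball_subset_closedBall))
    rw [Real.circleAverage, intervalIntegral.integral_of_le (by positivity)] at h
    simp only [zero_smul, add_zero] at h
    rw [← h, Complex.real_smul]
    push_cast
    have : (Real.pi : ℂ) ≠ 0 := by exact_mod_cast hpi.ne'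
    field_simp
  have hint : Integrable (Function.uncurry fun (θ : ℝ) (ζ : EuclideanSpace ℂ (Fin n)) =>
      u (a + circleMap 0 1 θ • ζ)) ((volume.restrict (Set.Ioc 0 (2 * Real.pi))).prod
        (volume.restrict (Metric.ball 0 r))) := by
    rw [Measure.prod_restrict]
    have hcpt : IsCompact (Set.Icc 0 (2 * Real.pi) ×ˢ
        Metric.closedBall (0 : EuclideanSpace ℂ (Fin n)) r) :=
      isCompact_Icc.prod (isCompact_closedBall _ _)
    have hcont : ContinuousOn (Function.uncurry fun (θ : ℝ) (ζ : EuclideanSpace ℂ (Fin n)) =>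
        u (a + circleMap 0 1 θ • ζ)) (Set.Icc 0 (2 * Real.pi) ×ˢ
        Metric.closedBall (0 : EuclideanSpace ℂ (Fin n)) r) := by
      refine hu.continuousOn.comp (f := fun q : ℝ × EuclideanSpace ℂ (Fin n) =>
        a + circleMap 0 1 q.1 • q.2) ?_ ?_
      · exact (continuous_const.add
          (((continuous_circleMap 0 1).comp continuous_fst).smul continuous_snd)).continuousOn
      · rintro ⟨θ, ζ⟩ ⟨-, hζ⟩
        exact hmem ζ (by simpa using hζ) _ (by simp)
    exact (hcont.integrableOn_compact hcpt).mono_set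
      (Set.prod_mono Set.Ioc_subset_Icc_self Metric.ball_subset_closedBall)
  have hswap := integral_integral_swap hint
  have hL : ∫ θ in Set.Ioc 0 (2 * Real.pi), (∫ ζ in Metric.ball (0 : EuclideanSpace ℂ (Fin n)) r,
      u (a + circleMap 0 1 θ • ζ)) = (2 * Real.pi) * I := by
    have : ∀ θ, ∫ ζ in Metric.ball (0 : EuclideanSpace ℂ (Fin n)) r,
      u (a + circleMap 0 1 θ • ζ) = I := fun θ => integral_ball_comp_smul u a r (by simp)
    simp only [this, setIntegral_const, measureReal_def, Real.volume_Ioc]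
    rw [ENNReal.toReal_ofReal (by linarith), Complex.real_smul]
    push_cast
    ring
  have hR : ∫ ζ in Metric.ball (0 : EuclideanSpace ℂ (Fin n)) r,
      (∫ θ in Set.Ioc 0 (2 * Real.pi), u (a + circleMap 0 1 θ • ζ)) =
      (volume (Metric.ball (0 : EuclideanSpace ℂ (Fin n)) r)).toReal * ((2 * Real.pi) * u a) := by
    rw [setIntegral_congr_fun Metric.isOpen_ball.measurableSet hslice, setIntegral_const,
      measureReal_def, Complex.real_smul]
  rw [hL, hR] at hswap
  rw [htrans, hvol]
  have h2 : (2 * Real.pi : ℂ) ≠ 0 := by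
    have : (Real.pi : ℂ) ≠ 0 := by exact_mod_cast hpi.ne'
    simp [this]
  refine mul_left_cancel₀ h2 ?_
  rw [hswap]
  ring

end MeanValue


/-! ### Point evaluations on the weighted Bergman space -/

section PointEvaluation

variable {n : ℕ}

lemma integral_ballMeasure {γ : ℝ} (f : EuclideanSpace ℂ (Fin n) → ℂ) :
    ∫ z, f z ∂(ballMeasure n γ) = ((rawBallMeasure n γ Set.univ)⁻¹).toReal *
      ∫ z in unitBall n, (((1 - ‖z‖ ^ 2) ^ γ : ℝ) : ℂ) * f z := by
  have hB : MeasurableSet (unitBall n) := Metric.isOpen_ball.measurableSet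
  rw [ballMeasure, integral_smul_measure, Complex.real_smul]
  congr 1
  unfold rawBallMeasure
  rw [integral_withDensity_eq_integral_toReal_smul (by fun_prop)
    (Filter.Eventually.of_forall fun _ => ENNReal.ofReal_lt_top)]
  refine setIntegral_congr_fun hB fun z hz => ?_
  have h1 : ‖z‖ < 1 := by simpa [unitBall] using hz
  have h2 : 0 ≤ (1 - ‖z‖ ^ 2) ^ γ := Real.rpow_nonneg (by nlinarith [norm_nonneg z]) _
  rw [ENNReal.toReal_ofReal h2, Complex.real_smul]

/-- Point evaluations are represented by continuous functionals on all of `L²`, with norm growing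
at most polynomially at the boundary. By the mean value property, the average over the Euclidean
ball of radius `(1 - |a|) / 2` around `a` is such a functional. -/
lemma exists_evaluation_functional (hn : 1 ≤ n) {γ : ℝ} (hγ : -1 < γ) :
    ∃ (K : ℝ) (k : ℕ), ∀ a ∈ unitBall n, ∃ A : Lp ℂ 2 (ballMeasure n γ) →L[ℂ] ℂ,
      ‖A‖ ≤ K * (1 - ‖a‖) ^ (-((k : ℝ) + 1 / 2)) ∧
      ∀ u : EuclideanSpace ℂ (Fin n) → ℂ, DifferentiableOn ℂ u (unitBall n) →
        ∀ q : Lp ℂ 2 (ballMeasure n γ), q =ᵐ[ballMeasure n γ] u → A q = u a := by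
  have := isProbabilityMeasure_ballMeasure hn hγ
  have hB : MeasurableSet (unitBall n) := Metric.isOpen_ball.measurableSet
  set c := ((rawBallMeasure n γ Set.univ)⁻¹).toReal with hc
  have hc0 : 0 < c := ENNReal.toReal_pos
    (ENNReal.inv_ne_zero.2 (rawBallMeasure_univ_ne_top hn hγ))
    (ENNReal.inv_ne_top.2 (rawBallMeasure_univ_ne_zero n γ))
  set d := Module.finrank ℝ (EuclideanSpace ℂ (Fin n)) with hd
  set V₁ := (volume (Metric.ball (0 : EuclideanSpace ℂ (Fin n)) 1)).toReal with hV₁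
  have hV₁0 : 0 < V₁ := ENNReal.toReal_pos (Metric.measure_ball_pos volume _ one_pos).ne'
    Metric.isBounded_ball.measure_lt_top.ne
  obtain ⟨k, hk⟩ := exists_nat_ge (|γ| + d)
  refine ⟨(c * V₁)⁻¹ * (1 / 2) ^ (-((k : ℝ) + 1 / 2)), k, fun a ha => ?_⟩
  have ha1 : ‖a‖ < 1 := by simpa [unitBall] using ha
  set r := (1 - ‖a‖) / 2 with hr
  have hr0 : 0 < r := by rw [hr]; linarith
  have hr1 : r < 1 := by rw [hr]; linarith [norm_nonneg a]
  have hsub : ∀ z ∈ Metric.ball a r, ‖z‖ < 1 ∧ r ≤ 1 - ‖z‖ ^ 2 := by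
    intro z hz
    have h1 : ‖z - a‖ < r := by simpa [dist_eq_norm] using hz
    have h2 : ‖z‖ ≤ ‖z - a‖ + ‖a‖ := by simpa using norm_add_le (z - a) a
    have h3 : ‖z‖ < 1 - r := by rw [hr] at h1 ⊢; linarith
    exact ⟨by linarith, by nlinarith [norm_nonneg z]⟩
  set V := (volume (Metric.ball a r)).toReal with hV
  have hVr : V = r ^ (d : ℝ) * V₁ := by
    rw [hV, Measure.addHaar_ball_of_pos volume a hr0, ENNReal.toReal_mul,
      ENNReal.toReal_ofReal (by positivity), Real.rpow_natCast]
  have hV0 : 0 < V := by rw [hVr]; positivity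
  set w : EuclideanSpace ℂ (Fin n) → ℝ := (Metric.ball a r).indicator
    fun z => ((1 - ‖z‖ ^ 2) ^ γ)⁻¹ * (c * V)⁻¹ with hw
  have hwm : Measurable w := Measurable.indicator (by fun_prop) Metric.isOpen_ball.measurableSet
  have hwb : ∀ z, ‖((w z : ℝ) : ℂ)‖ ≤
      (c * V₁)⁻¹ * (1 / 2) ^ (-((k : ℝ) + 1 / 2)) * (1 - ‖a‖) ^ (-((k : ℝ) + 1 / 2)) := by
    intro z
    have hrhs : (1 / 2 : ℝ) ^ (-((k : ℝ) + 1 / 2)) * (1 - ‖a‖) ^ (-((k : ℝ) + 1 / 2))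
        = r ^ (-((k : ℝ) + 1 / 2)) := by
      rw [← Real.mul_rpow (by norm_num) (by linarith)]; congr 1; rw [hr]; ring
    rw [mul_assoc, hrhs, Complex.norm_real]
    by_cases hz : z ∈ Metric.ball a r
    · obtain ⟨hz1, hz2⟩ := hsub z hz
      have hz3 : 0 < 1 - ‖z‖ ^ 2 := by linarith
      have hz4 : 1 - ‖z‖ ^ 2 ≤ 1 := by nlinarith [sq_nonneg ‖z‖]
      have h5 : ((1 - ‖z‖ ^ 2) ^ γ)⁻¹ ≤ r ^ (-|γ|) := by
        rw [← Real.rpow_neg hz3.le]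
        calc (1 - ‖z‖ ^ 2) ^ (-γ) ≤ (1 - ‖z‖ ^ 2) ^ (-|γ|) :=
              Real.rpow_le_rpow_of_exponent_ge hz3 hz4 (neg_le_neg (le_abs_self γ))
          _ ≤ r ^ (-|γ|) := Real.rpow_le_rpow_of_nonpos hr0 hz2 (by simp)
      have h6 : (c * V)⁻¹ = (c * V₁)⁻¹ * r ^ (-(d : ℝ)) := by
        rw [hVr, Real.rpow_neg hr0.le]
        field_simp
      have h7 : 0 ≤ ((1 - ‖z‖ ^ 2) ^ γ)⁻¹ := inv_nonneg.2 (Real.rpow_nonneg hz3.le _)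
      rw [hw, Set.indicator_of_mem hz, Real.norm_of_nonneg (by positivity), h6]
      calc ((1 - ‖z‖ ^ 2) ^ γ)⁻¹ * ((c * V₁)⁻¹ * r ^ (-(d : ℝ)))
          ≤ r ^ (-|γ|) * ((c * V₁)⁻¹ * r ^ (-(d : ℝ))) := by gcongr
        _ = (c * V₁)⁻¹ * r ^ (-|γ| + -(d : ℝ)) := by rw [Real.rpow_add hr0]; ring
        _ ≤ (c * V₁)⁻¹ * r ^ (-((k : ℝ) + 1 / 2)) := by
          gcongr ?_ * ?_
          exact Real.rpow_le_rpow_of_exponent_ge hr0 hr1.le (by linarith)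
    · rw [hw, Set.indicator_of_notMem hz, norm_zero]
      positivity
  have hwL : MemLp (fun z => ((w z : ℝ) : ℂ)) 2 (ballMeasure n γ) :=
    MemLp.of_bound (by fun_prop) _ (Filter.Eventually.of_forall hwb)
  refine ⟨innerSL ℂ hwL.toLp, ?_, fun u hu q hq => ?_⟩
  · rw [innerSL_apply_norm, Lp.norm_toLp]
    have h1 := eLpNorm_le_of_ae_bound (p := 2) (μ := ballMeasure n γ)
      (Filter.Eventually.of_forall hwb)
    rw [measure_univ, ENNReal.one_rpow, one_mul] at h1
    exact ENNReal.toReal_le_of_le_ofReal ((norm_nonneg _).trans (hwb a)) h1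
  · have h1 : innerSL ℂ hwL.toLp q = ∫ z, ((w z : ℝ) : ℂ) * u z ∂(ballMeasure n γ) := by
      rw [innerSL_apply_apply, L2.inner_def]
      refine integral_congr_ae ?_
      filter_upwards [hwL.coeFn_toLp, hq] with z h1 h2
      rw [h1, h2]
      simp [mul_comm]
    rw [h1, integral_ballMeasure, ← hc]
    have h2 : ∫ z in unitBall n, (((1 - ‖z‖ ^ 2) ^ γ : ℝ) : ℂ) * (((w z : ℝ) : ℂ) * u z)
        = ∫ z in unitBall n, (Metric.ball a r).indicator
          (fun z => (((c * V)⁻¹ : ℝ) : ℂ) * u z) z := by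
      refine setIntegral_congr_fun hB fun z _ => ?_
      simp only [hw]
      by_cases hz : z ∈ Metric.ball a r
      · have hz3 : 0 < 1 - ‖z‖ ^ 2 := by linarith [(hsub z hz).2]
        have h3 : ((((1 - ‖z‖ ^ 2) ^ γ : ℝ)) : ℂ) ≠ 0 := by
          exact_mod_cast (Real.rpow_pos_of_pos hz3 γ).ne'
        rw [Set.indicator_of_mem hz, Set.indicator_of_mem hz]
        push_cast
        field_simp
      · rw [Set.indicator_of_notMem hz, Set.indicator_of_notMem hz]
        simp
    have h3 : Metric.ball a r ⊆ unitBall n := fun z hz => by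
      simpa [unitBall] using (hsub z hz).1
    rw [h2, setIntegral_indicator Metric.isOpen_ball.measurableSet,
      Set.inter_eq_self_of_subset_right h3, integral_const_mul,
      integral_ball_eq_measure_mul hu (by rw [hr]; linarith), ← hV]
    have h4 : (c : ℂ) ≠ 0 := by exact_mod_cast hc0.ne'
    have h5 : (V : ℂ) ≠ 0 := by exact_mod_cast hV0.ne'
    push_cast
    field_simp

/-! ### Functions depending smoothly on a rotation -/

/-- If the rotations `u (e ^ (iλθ) ·)` of a holomorphic function depend smoothly on `θ` near `0`
as elements of `L²`, then `u` is bounded. Evaluating the derivatives of the `L²`-valued map at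
points gives polynomial bounds for all iterated Euler derivatives on all complex lines through `0`,
with constants independent of the line. -/
theorem exists_bound_of_contDiffOn_rotation (hn : 1 ≤ n) {γ : ℝ} (hγ : -1 < γ)
    {u : EuclideanSpace ℂ (Fin n) → ℂ} (hu : DifferentiableOn ℂ u (unitBall n)) {l r : ℝ}
    (hl : l ≠ 0) (hr : 0 < r) {G : ℝ → Lp ℂ 2 (ballMeasure n γ)}
    (hG : ContDiffOn ℝ ((⊤ : ℕ∞) : WithTop ℕ∞) G (Set.Ioo (-r) r))
    (hGu : ∀ θ ∈ Set.Ioo (-r) r, G θ =ᵐ[ballMeasure n γ]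
      fun z => u (Complex.exp (l * θ * Complex.I) • z)) :
    ∃ K : ℝ, ∀ z ∈ unitBall n, ‖u z‖ ≤ K := by
  obtain ⟨K₀, k, hA⟩ := exists_evaluation_functional hn hγ
  have hK₀ : 0 ≤ K₀ := by
    obtain ⟨A, hA1, -⟩ := hA 0 (by simp [unitBall])
    have := (norm_nonneg _).trans hA1
    simpa using this
  have hGj : ∀ j, ContDiffOn ℝ ((⊤ : ℕ∞) : WithTop ℕ∞) (deriv^[j] G) (Set.Ioo (-r) r) := by
    intro j
    induction j with
    | zero => exact hG
    | succ j ih =>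
      rw [Function.iterate_succ_apply']
      exact ih.deriv_of_isOpen isOpen_Ioo le_rfl
  obtain ⟨K, hK⟩ := exists_bound_of_iterate_euler_le k fun j => ‖deriv^[j] G 0‖ * K₀ / |l| ^ j
  refine ⟨K, fun z hz => ?_⟩
  -- `f` is the restriction of `u` to the complex line through `z`
  have hz1 : ‖z‖ < 1 := by simpa [unitBall] using hz
  obtain ⟨z₀, ζ₀, hζ₀, hzζ, hline⟩ : ∃ (z₀ : EuclideanSpace ℂ (Fin n)) (ζ₀ : ℂ),
      ‖ζ₀‖ < 1 ∧ ζ₀ • z₀ = z ∧ ∀ ζ : ℂ, ‖ζ • z₀‖ ≤ ‖ζ‖ := by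
    rcases eq_or_ne z 0 with rfl | hz0
    · exact ⟨0, 0, by simp, by simp, by simp⟩
    · have h0 : ‖z‖ ≠ 0 := norm_ne_zero_iff.2 hz0
      refine ⟨((‖z‖ : ℂ)⁻¹) • z, (‖z‖ : ℂ), ?_, ?_, fun ζ => ?_⟩
      · simpa using hz1
      · have : (‖z‖ : ℂ) ≠ 0 := by exact_mod_cast h0
        rw [smul_smul, mul_inv_cancel₀ this, one_smul]
      · simp [norm_smul, h0]
  set f : ℂ → ℂ := fun ζ => u (ζ • z₀) with hf
  have hfd : DifferentiableOn ℂ f (Metric.ball 0 1) := by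
    refine hu.comp (by fun_prop) fun ζ hζ => ?_
    have h1 : ‖ζ‖ < 1 := by simpa using hζ
    simpa [unitBall] using (hline ζ).trans_lt h1
  have hmain : ∀ j ζ, ‖ζ‖ < 1 → ‖euler^[j] f ζ‖ ≤
      ‖deriv^[j] G 0‖ * K₀ / |l| ^ j * (1 - ‖ζ‖) ^ (-((k : ℝ) + 1 / 2)) := by
    intro j ζ hζ
    have haB : ζ • z₀ ∈ unitBall n := by simpa [unitBall] using (hline ζ).trans_lt hζ
    obtain ⟨A, hA1, hA2⟩ := hA (ζ • z₀) haB
    have he1 : ∀ θ : ℝ, ‖Complex.exp (l * θ * Complex.I)‖ = 1 := fun θ => by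
      have := Complex.norm_exp_ofReal_mul_I (l * θ)
      push_cast at this
      exact this
    have hiter : ∀ j, ∀ θ ∈ Set.Ioo (-r) r, A (deriv^[j] G θ) =
        (l * Complex.I) ^ j * euler^[j] f (Complex.exp (l * θ * Complex.I) * ζ) := by
      intro j
      induction j with
      | zero =>
        intro θ hθ
        have hd : DifferentiableOn ℂ (fun z => u (Complex.exp (l * θ * Complex.I) • z))
            (unitBall n) := by
          refine hu.comp (by fun_prop) fun v hv => ?_
          have : ‖v‖ < 1 := by simpa [unitBall] using hv
          simpa [unitBall, norm_smul, he1] using this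
        rw [Function.iterate_zero, id, hA2 _ hd _ (hGu θ hθ)]
        simp [hf, smul_smul]
      | succ j ih =>
        intro θ hθ
        have hnhds : Set.Ioo (-r) r ∈ 𝓝 θ := isOpen_Ioo.mem_nhds hθ
        have hdiff : DifferentiableAt ℝ (deriv^[j] G) θ :=
          ((hGj j).contDiffAt hnhds).differentiableAt (by simp)
        have hleft : HasDerivAt (fun θ => A (deriv^[j] G θ)) (A (deriv (deriv^[j] G) θ)) θ :=
          (A.restrictScalars ℝ).hasFDerivAt.comp_hasDerivAt θ hdiff.hasDerivAt
        set E : ℝ → ℂ := fun θ => Complex.exp (l * θ * Complex.I) * ζ with hE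
        have hEd : HasDerivAt E (l * Complex.I * E θ) θ := by
          have h1 : HasDerivAt (fun θ : ℝ => (l : ℂ) * θ * Complex.I) (l * Complex.I) θ := by
            simpa using ((Complex.ofRealCLM.hasDerivAt (x := θ)).const_mul (l : ℂ)).mul_const
              Complex.I
          refine ((h1.cexp).mul_const ζ).congr_deriv ?_
          rw [hE]; ring
        have hEm : E θ ∈ Metric.ball (0 : ℂ) 1 := by
          rw [mem_ball_zero_iff, hE, norm_mul, he1, one_mul]; exact hζ
        have hfj : HasDerivAt (euler^[j] f) (deriv (euler^[j] f) (E θ)) (E θ) :=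
          ((differentiableOn_iterate_euler hfd j).differentiableAt
            (Metric.isOpen_ball.mem_nhds hEm)).hasDerivAt
        have hright : HasDerivAt (fun θ => (l * Complex.I) ^ j * euler^[j] f (E θ))
            ((l * Complex.I) ^ j * (deriv (euler^[j] f) (E θ) * (l * Complex.I * E θ))) θ :=
          (hfj.comp θ hEd).const_mul _
        have heq : (fun θ => A (deriv^[j] G θ)) =ᶠ[𝓝 θ]
            fun θ => (l * Complex.I) ^ j * euler^[j] f (E θ) :=
          Filter.eventually_of_mem hnhds fun θ hθ => ih θ hθ
        rw [Function.iterate_succ_apply', hleft.unique (hright.congr_of_eventuallyEq heq),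
          Function.iterate_succ_apply', euler]
        simp only [hE]
        ring
    have h0 := hiter j 0 ⟨by linarith, hr⟩
    simp only [Complex.ofReal_zero, mul_zero, zero_mul, Complex.exp_zero, one_mul] at h0
    have hlj : 0 < |l| ^ j := pow_pos (abs_pos.2 hl) j
    have hnorm : |l| ^ j * ‖euler^[j] f ζ‖ = ‖A (deriv^[j] G 0)‖ := by
      rw [h0, norm_mul, norm_pow, norm_mul, Complex.norm_I, mul_one, Complex.norm_real,
        Real.norm_eq_abs]
    have hle : ‖A (deriv^[j] G 0)‖ ≤ K₀ * (1 - ‖ζ‖) ^ (-((k : ℝ) + 1 / 2)) * ‖deriv^[j] G 0‖ := by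
      refine (A.le_opNorm _).trans (mul_le_mul_of_nonneg_right (hA1.trans ?_) (norm_nonneg _))
      refine mul_le_mul_of_nonneg_left ?_ hK₀
      refine Real.rpow_le_rpow_of_nonpos (by linarith) (by linarith [hline ζ]) ?_
      have : (0 : ℝ) ≤ k := by positivity
      linarith
    rw [div_mul_eq_mul_div, le_div_iff₀ hlj, mul_comm, hnorm]
    linarith
  have := hK f hfd hmain ζ₀ hζ₀
  simp only [hf, hzζ] at this
  exact this

end PointEvaluation


/-! ### Smooth vectors are bounded -/

section SmoothVector

variable {n : ℕ}

lemma J_eq_diagonal (n : ℕ) : J n = Matrix.diagonal (Sum.elim (fun _ => -1) fun _ => 1) := by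
  ext i j
  rcases i with i | i <;> rcases j with j | j <;>
    simp [J, Matrix.fromBlocks, Matrix.diagonal_apply, Matrix.one_apply]
  split_ifs <;> simp

/-- The eigenvalues `e ^ (iθ)` (`n` times) and `e ^ (-inθ)` of a central element of
`S(U(n) × U(1))`. -/
noncomputable def torusEntry (n : ℕ) (θ : ℝ) : Fin n ⊕ Unit → ℂ :=
  Sum.elim (fun _ => Complex.exp (θ * Complex.I)) fun _ => Complex.exp (-(n * θ) * Complex.I)

lemma torusEntry_mul (θ₁ θ₂ : ℝ) (i : Fin n ⊕ Unit) :
    torusEntry n θ₁ i * torusEntry n θ₂ i = torusEntry n (θ₁ + θ₂) i := by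
  rcases i with i | i <;> simp only [torusEntry, Sum.elim_inl, Sum.elim_inr, ← Complex.exp_add] <;>
    congr 1 <;> push_cast <;> ring

lemma torusEntry_zero (i : Fin n ⊕ Unit) : torusEntry n 0 i = 1 := by
  rcases i with i | i <;> simp [torusEntry]

lemma star_torusEntry (θ : ℝ) (i : Fin n ⊕ Unit) :
    star (torusEntry n θ i) = torusEntry n (-θ) i := by
  rcases i with i | i <;> simp [torusEntry, ← Complex.exp_conj]

/-- The one-parameter group `diag(e ^ (iθ), …, e ^ (iθ), e ^ (-inθ))` of `SU(n,1)`, which acts on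
the ball by rotations of all coordinates. -/
noncomputable def torus (n : ℕ) (θ : ℝ) : SU n :=
  ⟨⟨Matrix.diagonal (torusEntry n θ), by
    rw [Matrix.det_diagonal, Fintype.prod_sum_type]
    simp only [torusEntry, Sum.elim_inl, Sum.elim_inr, Finset.prod_const, Finset.card_univ,
      Fintype.card_fin, Fintype.card_unit, pow_one, ← Complex.exp_nat_mul, ← Complex.exp_add]
    rw [← Complex.exp_zero]
    congr 1
    ring⟩, by
    change (Matrix.diagonal (torusEntry n θ))ᴴ * J n * Matrix.diagonal (torusEntry n θ) = J n
    rw [J_eq_diagonal, Matrix.diagonal_conjTranspose, Matrix.diagonal_mul_diagonal,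
      Matrix.diagonal_mul_diagonal]
    congr 1
    ext i
    rw [Pi.star_apply, star_torusEntry, mul_right_comm, torusEntry_mul, neg_add_cancel,
      torusEntry_zero, one_mul]⟩

lemma coe_torus (θ : ℝ) : (torus n θ).1.1 = Matrix.diagonal (torusEntry n θ) := rfl

lemma torus_zero : torus n 0 = 1 := by
  apply Subtype.ext
  apply Subtype.ext
  change Matrix.diagonal (torusEntry n 0) = 1
  rw [show torusEntry n 0 = fun _ => 1 from funext torusEntry_zero, Matrix.diagonal_one]

lemma torus_inv (θ : ℝ) : (torus n θ)⁻¹ = torus n (-θ) := by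
  refine inv_eq_of_mul_eq_one_right ?_
  rw [← torus_zero]
  apply Subtype.ext
  apply Subtype.ext
  change Matrix.diagonal (torusEntry n θ) * Matrix.diagonal (torusEntry n (-θ)) =
    Matrix.diagonal (torusEntry n 0)
  rw [Matrix.diagonal_mul_diagonal]
  congr 1
  ext i
  rw [torusEntry_mul, add_neg_cancel]

lemma contDiff_entries_torus : ContDiff ℝ ((⊤ : ℕ∞) : WithTop ℕ∞) fun θ => entries (torus n θ) := by
  refine contDiff_pi.2 fun i => contDiff_pi.2 fun j => ?_
  have h : ContDiff ℝ ((⊤ : ℕ∞) : WithTop ℕ∞) fun θ => torusEntry n θ i := by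
    have h1 : ContDiff ℝ ((⊤ : ℕ∞) : WithTop ℕ∞) fun θ : ℝ => (θ : ℂ) := Complex.ofRealCLM.contDiff
    rcases i with i | i
    · exact (h1.mul contDiff_const).cexp
    · exact ((contDiff_const.mul h1).neg.mul contDiff_const).cexp
  simp only [entries, coe_torus, Matrix.diagonal_apply]
  split_ifs
  · exact h
  · exact contDiff_const

lemma blockD_torus (θ : ℝ) : blockD (torus n θ) = Complex.exp (-(n * θ) * Complex.I) := by
  simp [blockD, coe_torus, torusEntry]

lemma blockB_torus (θ : ℝ) (i : Fin n) : blockB (torus n θ) i = 0 := by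
  simp [blockB, coe_torus]

lemma act_torus (θ : ℝ) (z : EuclideanSpace ℂ (Fin n)) :
    act (torus n θ) z = Complex.exp ((n + 1) * θ * Complex.I) • z := by
  ext i
  have hA : ∀ i j, blockA (torus n θ) i j = if i = j then Complex.exp (θ * Complex.I) else 0 := by
    intro i j
    simp [blockA, coe_torus, torusEntry, Matrix.diagonal_apply]
  have hC : ∀ j, blockC (torus n θ) j = 0 := fun j => by simp [blockC, coe_torus]
  simp only [act, hA, hC, blockB_torus, blockD_torus, ite_mul, zero_mul, Finset.sum_ite_eq,
    Finset.mem_univ, if_true, add_zero, Finset.sum_const_zero, zero_add, PiLp.smul_apply,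
    smul_eq_mul, ← Complex.exp_neg]
  rw [mul_right_comm, ← Complex.exp_add]
  congr 2
  ring

/-- On the torus, `ρ_s` is a rotation of the variable up to a unimodular factor, smooth near the
identity. -/
lemma rho_torus (a : SU n → Circle) (s : ℝ) {θ : ℝ} (hθ : n * |θ| < Real.pi)
    (u : EuclideanSpace ℂ (Fin n) → ℂ) (z : EuclideanSpace ℂ (Fin n)) :
    rho a s (torus n θ) u z = (a (torus n θ) : ℂ) * Complex.exp (-(n * s * θ) * Complex.I) *
      u (Complex.exp ((-(n + 1) : ℝ) * θ * Complex.I) • z) := by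
  have hstar : star (blockD (torus n θ)) = Complex.exp (n * θ * Complex.I) := by
    rw [blockD_torus, Complex.star_def, ← Complex.exp_conj]
    simp
  have him : (n * θ * Complex.I : ℂ).im = n * θ := by simp
  have habs : |n * θ| < Real.pi := by rwa [abs_mul, Nat.abs_cast]
  have hpow : (Complex.exp (n * θ * Complex.I)) ^ (-(s : ℂ))
      = Complex.exp (-(n * s * θ) * Complex.I) := by
    rw [Complex.cpow_def_of_ne_zero (Complex.exp_ne_zero _),
      Complex.log_exp (by rw [him]; exact (abs_lt.1 habs).1)
        (by rw [him]; exact (abs_lt.1 habs).2.le)]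
    congr 1; ring
  rw [rho, hstar, hpow, torus_inv, act_torus]
  simp only [blockB_torus, star_zero, mul_zero, Finset.sum_const_zero, zero_div, sub_zero,
    Complex.one_cpow, mul_one]
  congr 3
  push_cast
  ring_nf

/-- Smooth vectors of `ρ_s` are bounded functions on the ball. -/
theorem IsSmoothVector.exists_bound (hn : 1 ≤ n) {s : ℝ} (hs : n < s) {a : SU n → Circle}
    (ha : IsPhase a) {u : EuclideanSpace ℂ (Fin n) → ℂ} (hu : IsSmoothVector a s u) :
    ∃ K : ℝ, ∀ z ∈ unitBall n, ‖u z‖ ≤ K := by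
  obtain ⟨⟨hud, -⟩, q, hq, U₁, hU₁, h1U₁, Q₁, hQ₁, hqQ⟩ := hu
  obtain ⟨U₂, hU₂, h1U₂, Q₂, hQ₂, haQ⟩ := ha.smooth
  have hn0 : (0 : ℝ) < n := by exact_mod_cast hn
  have hcont : Continuous fun θ => entries (torus n θ) := contDiff_entries_torus.continuous
  obtain ⟨r₀, hr₀, hball⟩ : ∃ r₀ > 0, ∀ θ ∈ Set.Ioo (-r₀) r₀,
      entries (torus n θ) ∈ U₁ ∧ entries (torus n θ) ∈ U₂ := by
    have h0 : (0 : ℝ) ∈ (fun θ => entries (torus n θ)) ⁻¹' (U₁ ∩ U₂) := by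
      simp only [Set.mem_preimage, torus_zero]
      exact ⟨h1U₁, h1U₂⟩
    obtain ⟨r₀, hr₀, h⟩ := Metric.isOpen_iff.1 ((hU₁.inter hU₂).preimage hcont) 0 h0
    refine ⟨r₀, hr₀, fun θ hθ => h ?_⟩
    rw [Real.ball_eq_Ioo]
    simpa using hθ
  set r := min r₀ (Real.pi / n) with hr
  have hr0 : 0 < r := lt_min hr₀ (div_pos Real.pi_pos hn0)
  have hsub : ∀ θ ∈ Set.Ioo (-r) r, θ ∈ Set.Ioo (-r₀) r₀ ∧ n * |θ| < Real.pi := by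
    intro θ hθ
    have h1 : |θ| < r := abs_lt.2 hθ
    refine ⟨abs_lt.1 (h1.trans_le (min_le_left _ _)), ?_⟩
    have h2 := h1.trans_le (min_le_right _ _)
    rw [lt_div_iff₀ hn0] at h2
    linarith
  have hsm : ∀ {F : Type} [NormedAddCommGroup F] [NormedSpace ℝ F]
      {U : Set ((Fin n ⊕ Unit) → (Fin n ⊕ Unit) → ℂ)} {Q : _ → F},
      ContDiffOn ℝ ((⊤ : ℕ∞) : WithTop ℕ∞) Q U →
      (∀ θ ∈ Set.Ioo (-r) r, entries (torus n θ) ∈ U) →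
      ContDiffOn ℝ ((⊤ : ℕ∞) : WithTop ℕ∞) (fun θ => Q (entries (torus n θ))) (Set.Ioo (-r) r) :=
    fun hQ hU => hQ.comp contDiff_entries_torus.contDiffOn hU
  set G₁ := fun θ => Q₁ (entries (torus n θ)) with hG₁
  set c : ℝ → ℂ := fun θ => star (Q₂ (entries (torus n θ))) *
    Complex.exp (n * s * θ * Complex.I) with hc
  have hcd : ContDiffOn ℝ ((⊤ : ℕ∞) : WithTop ℕ∞) c (Set.Ioo (-r) r) := by
    have h1 : ContDiff ℝ ((⊤ : ℕ∞) : WithTop ℕ∞) fun θ : ℝ => (θ : ℂ) := Complex.ofRealCLM.contDiff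
    have h2 : ContDiff ℝ ((⊤ : ℕ∞) : WithTop ℕ∞) fun θ : ℝ =>
        Complex.exp (n * s * θ * Complex.I) :=
      ((contDiff_const.mul h1).mul contDiff_const).cexp
    have h3 := hsm hQ₂ fun θ hθ => (hball θ (hsub θ hθ).1).2
    have h4 : ContDiffOn ℝ ((⊤ : ℕ∞) : WithTop ℕ∞)
        (fun θ => star (Q₂ (entries (torus n θ)))) (Set.Ioo (-r) r) :=
      Complex.conjCLE.contDiff.comp_contDiffOn h3
    exact h4.mul h2.contDiffOn
  have hGd := hcd.smul (hsm hQ₁ fun θ hθ => (hball θ (hsub θ hθ).1).1)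
  refine exists_bound_of_contDiffOn_rotation hn (γ := s - n - 1) (by linarith) hud
    (l := -(n + 1 : ℝ)) (by linarith) hr0 hGd fun θ hθ => ?_
  obtain ⟨hθ0, hθπ⟩ := hsub θ hθ
  obtain ⟨hθ1, hθ2⟩ := hball θ hθ0
  have hG : G₁ θ = q (torus n θ) := (hqQ _ hθ1).symm
  have hsmul := Lp.coeFn_smul (c θ) (G₁ θ)
  filter_upwards [hsmul, hq (torus n θ)] with z h1 h2
  change (c θ • G₁ θ : Lp ℂ 2 (ballMeasure n (s - n - 1))) z = _
  rw [h1, Pi.smul_apply, hG, h2, rho_torus a s hθπ, smul_eq_mul, hc]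
  simp only
  rw [← haQ _ hθ2]
  have e1 : star (a (torus n θ) : ℂ) * (a (torus n θ) : ℂ) = 1 := by
    rw [Complex.star_def, mul_comm, Complex.mul_conj, Circle.normSq_coe, Complex.ofReal_one]
  have e2 : Complex.exp (n * s * θ * Complex.I) * Complex.exp (-(n * s * θ) * Complex.I) = 1 := by
    rw [← Complex.exp_add, ← Complex.exp_zero]; congr 1; ring
  calc _ = (star (a (torus n θ) : ℂ) * (a (torus n θ) : ℂ)) *
        (Complex.exp (n * s * θ * Complex.I) * Complex.exp (-(n * s * θ) * Complex.I)) *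
        u (Complex.exp ((-(n + 1) : ℝ) * θ * Complex.I) • z) := by ring
    _ = _ := by rw [e1, e2, one_mul, one_mul]

end SmoothVector


/-! ### Wavelet transforms -/

section Wavelet

variable {n : ℕ} {a : SU n → Circle} {s : ℝ} {u v : EuclideanSpace ℂ (Fin n) → ℂ}

lemma inner_act_zero (x : SU n) (z : EuclideanSpace ℂ (Fin n)) :
    inner ℂ (act x 0) z = (∑ i, z i * star (blockB x i)) / star (blockD x) := by
  rw [PiLp.inner_apply, Finset.sum_div]
  refine Finset.sum_congr rfl fun i _ => ?_
  simp [act, div_eq_mul_inv, mul_assoc]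

lemma norm_rho (x : SU n) (f : EuclideanSpace ℂ (Fin n) → ℂ) (z : EuclideanSpace ℂ (Fin n)) :
    ‖rho a s x f z‖ =
      ‖blockD x‖ ^ (-s) * ‖1 - inner ℂ (act x 0) z‖ ^ (-s) * ‖f (act x⁻¹ z)‖ := by
  have h : (-(s : ℂ)) = ((-s : ℝ) : ℂ) := by push_cast; rfl
  rw [rho, ← inner_act_zero, h, norm_mul, norm_mul, norm_mul, Complex.norm_cpow_real,
    Complex.norm_cpow_real, norm_star, Circle.norm_coe, one_mul]

lemma norm_act_zero_lt_one (x : SU n) : ‖act x 0‖ < 1 := by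
  have h : (0 : EuclideanSpace ℂ (Fin n)) ∈ unitBall n := by simp [unitBall]
  simpa [unitBall] using act_mem_unitBall x h

/-- Reverse Cauchy–Schwarz on the ball, in terms of the matrix coefficient `d`. -/
lemma le_norm_one_sub_inner_act_zero (x : SU n) {z : EuclideanSpace ℂ (Fin n)}
    (hz : z ∈ unitBall n) :
    (2 * ‖blockD x‖ ^ 2)⁻¹ ≤ ‖1 - inner ℂ (act x 0) z‖ := by
  have h1 := one_sub_norm_act_zero_sq x
  have h2 := norm_act_zero_lt_one x
  have h3 : ‖z‖ ≤ 1 := (by simpa [unitBall] using hz : ‖z‖ < 1).le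
  have h4 : ‖inner ℂ (act x 0) z‖ ≤ ‖act x 0‖ :=
    (norm_inner_le_norm _ _).trans (mul_le_of_le_one_right (norm_nonneg _) h3)
  have h5 := norm_sub_norm_le (1 : ℂ) (inner ℂ (act x 0) z)
  rw [norm_one] at h5
  rw [mul_inv, ← h1]
  nlinarith [norm_nonneg (act x 0)]

/-- For bounded `u` and `v` the wavelet transform decays like every power of `|d|` with exponent
above `-s`: part of the power `|1 - (z, w)| ^ (-s)`, `w = x · 0`, is traded for a small power of
`|d|`, and the rest is integrable uniformly in `w` by the Forelli–Rudin estimate. -/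
lemma exists_norm_wavelet_le (hn : 1 ≤ n) (hs : (n : ℝ) < s) {Ku Kv : ℝ}
    (hu : ∀ z ∈ unitBall n, ‖u z‖ ≤ Ku) (hv : ∀ z ∈ unitBall n, ‖v z‖ ≤ Kv) {τ : ℝ}
    (hτ : τ < s) :
    ∃ C : ℝ, ∀ x : SU n, ‖wavelet a s u v x‖ ≤ C * ‖blockD x‖ ^ (-τ) := by
  -- `2 (s - κ) = s - τ`, so that the power of `|d|` spent is the loss from `-s` to `-τ`
  set κ := (s + τ) / 2 with hκ
  obtain ⟨C, hC, h⟩ := exists_forelliRudin_bound hn (γ := s - n - 1) (κ := κ)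
    (by linarith) (by rw [hκ]; linarith)
  have hK : ∀ {f : EuclideanSpace ℂ (Fin n) → ℂ} {K : ℝ}, (∀ z ∈ unitBall n, ‖f z‖ ≤ K) →
      0 ≤ K := fun hf => (norm_nonneg _).trans (hf 0 (by simp [unitBall]))
  have hKu := hK hu
  have hKv := hK hv
  set V := (rawBallMeasure n (s - n - 1) Set.univ)⁻¹ with hV
  have hVt : V ≠ ⊤ := ENNReal.inv_ne_top.2 (rawBallMeasure_univ_ne_zero _ _)
  refine ⟨Kv * Ku * 2 ^ (s - κ) * (V * C).toReal, fun x => ?_⟩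
  have hd := norm_blockD_pos x
  set M := Kv * Ku * 2 ^ (s - κ) * ‖blockD x‖ ^ (-τ) with hM
  have hM0 : 0 ≤ M := by positivity
  have hpt : ∀ᵐ z ∂(ballMeasure n (s - n - 1)), ‖v z * star (rho a s x u z)‖ₑ ≤
      ENNReal.ofReal M * ENNReal.ofReal (‖1 - inner ℂ (act x 0) z‖ ^ (-κ)) := by
    filter_upwards [ae_mem_unitBall n (s - n - 1)] with z hz
    rw [← ofReal_norm, ← ENNReal.ofReal_mul hM0, norm_mul, norm_star, norm_rho]
    apply ENNReal.ofReal_le_ofReal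
    have h1 := le_norm_one_sub_inner_act_zero x hz
    have h0 : 0 < ‖1 - inner ℂ (act x 0) z‖ := lt_of_lt_of_le (by positivity) h1
    have h2 : ‖1 - inner ℂ (act x 0) z‖ ^ (-s) ≤
        (2 ^ (s - κ) * ‖blockD x‖ ^ (2 * (s - κ))) * ‖1 - inner ℂ (act x 0) z‖ ^ (-κ) := by
      have h3 : -s = -(s - κ) + -κ := by ring
      rw [h3, Real.rpow_add h0]
      gcongr
      have h4 := Real.rpow_le_rpow_of_nonpos (by positivity) h1
        (show -(s - κ) ≤ 0 by rw [hκ]; linarith)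
      rwa [Real.inv_rpow (by positivity), ← Real.rpow_neg (by positivity), neg_neg,
        Real.mul_rpow (by positivity) (by positivity), ← Real.rpow_natCast ‖blockD x‖ 2,
        ← Real.rpow_mul hd.le, Nat.cast_ofNat] at h4
    have h5 : ‖blockD x‖ ^ (-τ) = ‖blockD x‖ ^ (-s) * ‖blockD x‖ ^ (2 * (s - κ)) := by
      rw [← Real.rpow_add hd]
      congr 1
      rw [hκ]
      ring
    calc ‖v z‖ * (‖blockD x‖ ^ (-s) * ‖1 - inner ℂ (act x 0) z‖ ^ (-s) * ‖u (act x⁻¹ z)‖)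
        ≤ Kv * (‖blockD x‖ ^ (-s) * ((2 ^ (s - κ) * ‖blockD x‖ ^ (2 * (s - κ)))
            * ‖1 - inner ℂ (act x 0) z‖ ^ (-κ)) * Ku) := by
          gcongr
          · exact hv z hz
          · exact hu _ (act_mem_unitBall _ hz)
      _ = M * ‖1 - inner ℂ (act x 0) z‖ ^ (-κ) := by
          rw [hM, h5]
          ring
  have hint : ‖wavelet a s u v x‖ₑ ≤ ENNReal.ofReal M * (V * C) := by
    calc ‖wavelet a s u v x‖ₑ
        ≤ ∫⁻ z, ‖v z * star (rho a s x u z)‖ₑ ∂(ballMeasure n (s - n - 1)) :=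
          enorm_integral_le_lintegral_enorm _
      _ ≤ _ := lintegral_mono_ae hpt
      _ ≤ ENNReal.ofReal M * (V * C) := by
          rw [lintegral_const_mul' _ _ ENNReal.ofReal_ne_top, lintegral_ballMeasure]
          gcongr
          exact h _ (norm_act_zero_lt_one x)
  have hfin := ENNReal.toReal_mono
    (ENNReal.mul_ne_top ENNReal.ofReal_ne_top (ENNReal.mul_ne_top hVt hC)) hint
  rw [toReal_enorm, ENNReal.toReal_mul, ENNReal.toReal_ofReal hM0] at hfin
  refine hfin.trans (le_of_eq ?_)
  rw [hM]
  ring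

lemma measurable_act_inv :
    Measurable fun q : SU n × EuclideanSpace ℂ (Fin n) => act q.1⁻¹ q.2 := by
  have hinv : Continuous fun q : SU n × EuclideanSpace ℂ (Fin n) => q.1⁻¹ :=
    Continuous.comp (g := fun x : SU n => x⁻¹) (f := Prod.fst) continuous_inv continuous_fst
  have hA (i j : Fin n) := Continuous.comp (g := fun x : SU n => blockA x i j)
    (continuous_blockA i j) hinv
  have hB (i : Fin n) := Continuous.comp (g := fun x : SU n => blockB x i)
    (continuous_blockB i) hinv
  have hC (i : Fin n) := Continuous.comp (g := fun x : SU n => blockC x i)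
    (continuous_blockC i) hinv
  have hD := Continuous.comp (g := fun x : SU n => blockD x) continuous_blockD hinv
  simp only [Function.comp_def] at hA hB hC hD
  have hz (i : Fin n) : Continuous fun q : SU n × EuclideanSpace ℂ (Fin n) => q.2 i := by fun_prop
  refine (WithLp.measurable_toLp 2 (Fin n → ℂ)).comp
    (f := fun q : SU n × EuclideanSpace ℂ (Fin n) => fun i =>
    ((∑ j, blockA q.1⁻¹ i j * q.2 j) + blockB q.1⁻¹ i) *
      ((∑ j, blockC q.1⁻¹ j * q.2 j) + blockD q.1⁻¹)⁻¹) ?_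
  refine measurable_pi_lambda _ fun i => Measurable.mul ?_ (Measurable.inv ?_)
  · exact ((continuous_finsetSum _ fun j _ => (hA i j).mul (hz j)).add (hB i)).measurable
  · exact ((continuous_finsetSum _ fun j _ => (hC j).mul (hz j)).add hD).measurable

lemma measurable_indicator_unitBall {f : EuclideanSpace ℂ (Fin n) → ℂ} (hf : MemH s f) :
    Measurable ((unitBall n).indicator f) := by
  classical
  have hB : MeasurableSet (unitBall n) := Metric.isOpen_ball.measurableSet
  rw [← Set.piecewise_eq_indicator]
  exact ContinuousOn.measurable_piecewise hf.1.continuousOn continuousOn_const hB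

/-- The group element only enters through its entries and the phase; replacing `u` and `v` by `0`
outside the ball makes the integrand jointly measurable. -/
lemma measurable_wavelet (ha : IsPhase a) (hn : 1 ≤ n) (hs : (n : ℝ) < s) (hu : MemH s u)
    (hv : MemH s v) : Measurable (wavelet a s u v) := by
  have := isProbabilityMeasure_ballMeasure hn (γ := s - n - 1) (by linarith)
  have hu' := measurable_indicator_unitBall hu
  have hv' := measurable_indicator_unitBall hv
  set u' := (unitBall n).indicator u with hu'def
  set v' := (unitBall n).indicator v with hv'def
  have heq : wavelet a s u v = fun x => ∫ z, v' z * star (rho a s x u' z)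
      ∂(ballMeasure n (s - n - 1)) := by
    funext x
    refine integral_congr_ae ?_
    filter_upwards [ae_mem_unitBall n (s - n - 1)] with z hz
    rw [hv'def, Set.indicator_of_mem hz, rho, rho, hu'def,
      Set.indicator_of_mem (act_mem_unitBall _ hz)]
  rw [heq]
  have hrho : Measurable fun q : SU n × EuclideanSpace ℂ (Fin n) => rho a s q.1 u' q.2 := by
    have hd : Measurable fun q : SU n × EuclideanSpace ℂ (Fin n) => star (blockD q.1) :=
      (Continuous.star (continuous_blockD.comp continuous_fst)).measurable
    have hb (i : Fin n) : Measurable fun q : SU n × EuclideanSpace ℂ (Fin n) =>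
        q.2 i * star (blockB q.1 i) :=
      (Continuous.mul (by fun_prop)
        (Continuous.star ((continuous_blockB i).comp continuous_fst))).measurable
    have hact := hu'.comp measurable_act_inv
    exact (((ha.measurable.comp measurable_fst).mul (hd.pow_const _)).mul
      ((measurable_const.sub ((Finset.measurable_sum _ fun i _ => hb i).div hd)).pow_const _)).mul
        hact
  have hF : Measurable fun q : SU n × EuclideanSpace ℂ (Fin n) =>
      v' q.2 * star (rho a s q.1 u' q.2) :=
    (hv'.comp measurable_snd).mul (continuous_star.measurable.comp hrho)
  exact (StronglyMeasurable.integral_prod_right' (ν := ballMeasure n (s - n - 1))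
    hF.stronglyMeasurable).measurable

end Wavelet

end BallBergman

theorem mainTheorem7 (n : ℕ) (hn : 1 ≤ n) (s α : ℝ)
    (p : ℝ≥0∞) [Fact (1 ≤ p)] (hp : p ≠ ⊤)
    (hα : -1 < α) (hα' : α < p.toReal * (s - n) - 1)
    (μ : Measure (BallBergman.SU n)) [μ.IsHaarMeasure]
    (a : BallBergman.SU n → Circle) (ha : BallBergman.IsPhase a)
    (u v : EuclideanSpace ℂ (Fin n) → ℂ)
    (hu : BallBergman.IsSmoothVector a s u) (hv : BallBergman.IsSmoothVector a s v) :
    (∃ T : Lp ℂ p (BallBergman.weighted μ (α + n + 1 - s * p.toReal / 2)) →L[ℂ]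
          Lp ℂ p (BallBergman.weighted μ (α + n + 1 - s * p.toReal / 2)),
      ∀ f : Lp ℂ p (BallBergman.weighted μ (α + n + 1 - s * p.toReal / 2)),
        (∀ᵐ x ∂μ, Integrable
          (fun y => f y * ((‖BallBergman.wavelet a s u v (y⁻¹ * x)‖ : ℝ) : ℂ)) μ) ∧
        T f =ᵐ[μ] BallBergman.conv μ f
          (fun x => ((‖BallBergman.wavelet a s u v x‖ : ℝ) : ℂ))) ∧
    (∀ σ : BallBergman.SU n → BallBergman.SU n → Circle, BallBergman.IsMultiplier a s σ →
      ∃ T : Lp ℂ p (BallBergman.weighted μ (α + n + 1 - s * p.toReal / 2)) →L[ℂ]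
          Lp ℂ p (BallBergman.weighted μ (α + n + 1 - s * p.toReal / 2)),
      ∀ f : Lp ℂ p (BallBergman.weighted μ (α + n + 1 - s * p.toReal / 2)),
        (∀ᵐ x ∂μ, Integrable
          (fun y => f y * BallBergman.wavelet a s u v (y⁻¹ * x) *
            star (σ y (y⁻¹ * x) : ℂ)) μ) ∧
        T f =ᵐ[μ] BallBergman.twistedConv μ σ f (BallBergman.wavelet a s u v)) := by
  obtain ⟨τ, hτ, hT⟩ := BallBergman.exists_decay_exponent hn hp hα hα' μ
  have hs : (n : ℝ) < s := by
    have hP : 1 ≤ p.toReal := by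
      have := ENNReal.toReal_mono hp (Fact.out : 1 ≤ p)
      simpa using this
    by_contra! h
    nlinarith
  obtain ⟨Ku, hKu⟩ := hu.exists_bound hn hs ha
  obtain ⟨Kv, hKv⟩ := hv.exists_bound hn hs ha
  obtain ⟨C, hC⟩ := BallBergman.exists_norm_wavelet_le (a := a) hn hs hKu hKv hτ
  have hW : Measurable fun q : BallBergman.SU n × BallBergman.SU n =>
      BallBergman.wavelet a s u v (q.2⁻¹ * q.1) :=
    Measurable.comp (g := BallBergman.wavelet a s u v)
      (BallBergman.measurable_wavelet ha hn hs hu.1 hv.1) BallBergman.measurable_inv_mul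
  refine ⟨hT (fun x y => ((‖BallBergman.wavelet a s u v (y⁻¹ * x)‖ : ℝ) : ℂ)) ?_
    ⟨C, fun x y => ?_⟩, fun σ hσ => ?_⟩
  · exact Complex.measurable_ofReal.comp hW.norm
  · rw [Complex.norm_real, norm_norm]
    exact hC _
  · have hσm : Measurable fun q : BallBergman.SU n × BallBergman.SU n =>
        (σ q.2 (q.2⁻¹ * q.1) : ℂ) :=
      Measurable.comp
        (g := fun r : BallBergman.SU n × BallBergman.SU n => (σ r.1 r.2 : ℂ))
        (f := fun q : BallBergman.SU n × BallBergman.SU n => (q.2, q.2⁻¹ * q.1))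
        hσ.1 (measurable_snd.prodMk BallBergman.measurable_inv_mul)
    obtain ⟨T, h⟩ := hT (fun x y => BallBergman.wavelet a s u v (y⁻¹ * x) *
      star (σ y (y⁻¹ * x) : ℂ)) (hW.mul (continuous_star.measurable.comp hσm))
      ⟨C, fun x y => by rw [norm_mul, norm_star, Circle.norm_coe, mul_one]; exact hC _⟩
    refine ⟨T, fun f => ?_⟩
    have hf := h f
    simp only [← mul_assoc] at hf
    exact hf
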